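/- Let $d\ge 1$ and $n=2^d$. An arrangement of $n$ cards is a bijection $\pi$ from the set of cards to the set of $n$ positions, $\pi(i)$ being the position of card $i$ (cards are labelled by the positions themselves, so $\pi$ is a permutation). *Reverse Thorp shuffle.* The positions are the elements of $\{0,1\}^d$, written $x=(L,R)$ with $L\in\{0,1\}^{d-1}$ the leftmost $d-1$ bits and $R\in\{0,1\}$ the rightmost bit of $x$. In one step, take independent fair coin flips $Z(l)\in\{0,1\}$, $l\in\{0,1\}^{d-1}$, independent of all previous steps, and replace the current arrangement $\pi$ by $\nu\circ\pi$, where $\nu$ is the permutation of positions $(L,R)\mapsto(R\oplus Z(L),\,L)$. *(Forward) Thorp shuffle.* In one step, cut the deck into two equal piles; drop the bottom card of one of the two piles, chosen by a fair coin flip, then drop the bottom card of the other pile; continue in this way, with independent coin flips, until both piles are empty. For a Markov chain with transition probabilities $p(x,y)$ on a finite set $V$ let $$T_{\rm mix}=\min\Bigl\{t\ge 0:\ \sum_{y\in V}\Bigl|p^t(x,y)-\frac1{|V|}\Bigr|\le\frac14\ \text{ for all } x\in V\Bigr\}.$$ **Theorem.** There is a universal constant $C$ such that for every $d\ge1$ the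 mixing times $T_{\rm mix}$ of the reverse Thorp shuffle and of the forward Thorp shuffle with $n=2^d$ cards are finite and at most $C\,d^3=C(\log_2 n)^3$. -/

import Mathlib

namespace ThorpShuffle

/-- Total variation distance to the uniform distribution, in the normalisation
`‖μ - 𝒰‖ = ∑ x, |μ x - 𝒰 x|` (without the factor `1/2`). -/
noncomputable def distUniform {V : Type*} [Fintype V] (μ : V → ℝ) : ℝ :=
  ∑ x, |μ x - 1 / (Fintype.card V : ℝ)|

/-- The mixing time `min {t : ‖p^t(x, ·) - 𝒰‖ ≤ 1/4 for all x}` of the Markov chain with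
transition matrix `p`. The value is `⊤` if there is no such `t`. -/
noncomputable def mixingTime {V : Type*} [Fintype V] [DecidableEq V]
    (p : Matrix V V ℝ) : ℕ∞ :=
  ⨅ (t : ℕ) (_ : ∀ x : V, distUniform ((p ^ t) x) ≤ 1 / 4), (t : ℕ∞)

/-- The Markov chain on the permutations of `α` (a state `π` is the arrangement in which card `i`
is at position `π i`) in which a step from `π` goes to `ν ω ∘ π`, where `ω` is uniformly
distributed on the finite set `Ω` and is chosen independently at each step: the `(π, σ)` entry
is the probability that `ν ω ∘ π = σ`. -/
noncomputable def shuffleMatrix {Ω α : Type*} [Fintype Ω] [Fintype α] [DecidableEq α]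
    (ν : Ω → Equiv.Perm α) : Matrix (Equiv.Perm α) (Equiv.Perm α) ℝ :=
  Matrix.of fun π σ =>
    ((Finset.univ.filter fun ω : Ω => ν ω * π = σ).card : ℝ) / (Fintype.card Ω : ℝ)

/-- The positions `{0,1}^(k+1)`, written in binary with the leftmost bit at index `0`. The leftmost
`k` bits of `x` are `Fin.init x`, and its rightmost bit is `x (Fin.last k)`. -/
abbrev Cube (k : ℕ) : Type := Fin (k + 1) → Bool

/-- The permutation `(L, R) ↦ (R ⊕ Z L, L)` of the `2^(k+1)` positions, where `L` denotes the
leftmost `k` bits and `R` the rightmost bit. -/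
def reverseStep (k : ℕ) (Z : (Fin k → Bool) → Bool) : Equiv.Perm (Cube k) where
  toFun x := Fin.cons (xor (x (Fin.last k)) (Z (Fin.init x))) (Fin.init x)
  invFun y := Fin.snoc (Fin.tail y) (xor (y 0) (Z (Fin.tail y)))
  left_inv x := by
    simp [Fin.snoc_init_self]
  right_inv y := by
    simp [Fin.cons_self_tail]

/-- The reverse Thorp shuffle with `2^(k+1)` cards. A uniformly random function
`Z : {0,1}^k → {0,1}` is a family of independent fair coin flips `Z l`. -/
noncomputable def reverseThorp (k : ℕ) :
    Matrix (Equiv.Perm (Cube k)) (Equiv.Perm (Cube k)) ℝ :=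
  shuffleMatrix (reverseStep k)

/-- Exchange the two piles in the `i`-th pair of dropped cards whenever `Z i` is true. -/
def flipPairs (m : ℕ) (Z : Fin m → Bool) : Fin 2 × Fin m ≃ Fin m × Fin 2 where
  toFun x := (x.2, if Z x.2 then Fin.rev x.1 else x.1)
  invFun y := (if Z y.1 then Fin.rev y.2 else y.2, y.1)
  left_inv x := by
    by_cases h : Z x.2 <;> simp [h]
  right_inv y := by
    by_cases h : Z y.1 <;> simp [h]

/-- One Thorp shuffle of `2 * m` cards with given coin flips, positions counted from the bottom.
The deck is cut into the pile of the positions `0, …, m - 1` (`b = 0`) and that of the positions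
`m, …, 2 * m - 1` (`b = 1`), and the piles are dropped from the bottom. The `i`-th pair of dropped
cards consists of the cards at the positions `b * m + i`, `b = 0, 1`, and it fills the positions
`2 * i` and `2 * i + 1`: the card from pile `0` is dropped first if `Z i` is false, and the card
from pile `1` is dropped first if `Z i` is true. -/
def forwardStep (m : ℕ) (Z : Fin m → Bool) : Equiv.Perm (Fin (2 * m)) :=
  finProdFinEquiv.symm.trans
    ((flipPairs m Z).trans (finProdFinEquiv.trans (finCongr (Nat.mul_comm m 2))))

/-- The (forward) Thorp shuffle with `2 * m` cards, `Z 0, …, Z (m - 1)` being independent fair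
coin flips. -/
noncomputable def forwardThorp (m : ℕ) :
    Matrix (Equiv.Perm (Fin (2 * m))) (Equiv.Perm (Fin (2 * m))) ℝ :=
  shuffleMatrix (forwardStep m)

/-- The position of the dropped card, as explained in `forwardStep`. -/
theorem forwardStep_val (m : ℕ) (Z : Fin m → Bool) (b : Fin 2) (i : Fin m) (x : Fin (2 * m))
    (hx : (x : ℕ) = b * m + i) :
    (forwardStep m Z x : ℕ) = 2 * i + (if Z i then 1 - (b : ℕ) else b) := by
  have h : x = finProdFinEquiv (b, i) := by
    apply Fin.ext
    simp [hx, Nat.mul_comm, Nat.add_comm]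
  subst h
  by_cases hz : Z i <;> fin_cases b <;>
    simp [forwardStep, flipPairs, hz, Nat.add_comm, Fin.rev]

end ThorpShuffle

set_option linter.unusedSectionVars false

/-! The proof follows relative entropy. A law of arrangements is a function on the permutation
group, and a random move of positions acts on it as a mixture of left translations. With all
rotations pulled to the left, `k + 1` reverse steps become fair switches along the cube edges in
directions 0, …, k (`butterfly`). Write d = k + 1. One such round multiplies the relative entropy by
at most 1 - c/d (`entropySum_butterfly_le`). Since it starts at log n! ≤ exp(2d), O(d²) rounds, that
is O(d³) steps, make it small, and a Pinsker inequality concludes.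

The loss in a round is collected over dimensions. The subcube `low k (m + 1)` consists of the halves
`low k m` and `upper k m`, which direction m joins. The earlier switches in the upper half absorb a
uniformly random mask on the lower m bits (`butterfly_mul_maskPerm`). Hence each upper position may
be taken to be matched to a uniformly distributed lower one. Different positions are matched
dependently, but only the individual marginals are needed.

For such a random matching (`sum_entropySum_edgeAvg_le`) positions are peeled off one at a time.
Switching k with b loses at least 1/8 of the triangular discrimination between the law and its
swapped version. Forgetting other cards only decreases this quantity, and averaging over b compares
the conditional law of the card at k with a mean over the lower half. For a suitable k this controls
the comparison with the mean over all remaining positions, and there the discrimination dominates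
relative entropy up to a factor 4 + 3 log n, the source of the c/d. The relative entropies obtained
are chain rule increments, which telescope over the positions and then over m.

The forward shuffle is, after relabelling, the time reversal of the reverse one, and for a random
walk on a group the reversal has the same distance to uniformity. -/

namespace ThorpShuffle

/-! ### Translations, their mixtures, and averages over subgroups -/

section Translation

variable {G : Type*} [Group G]

/-- Left translation of functions on a group. -/
def translate : G →* Module.End ℝ (G → ℝ) where
  toFun g := LinearMap.funLeft ℝ ℝ fun x => g⁻¹ * x
  map_one' := by ext; simp [LinearMap.funLeft]
  map_mul' g h := by
    refine LinearMap.ext fun f => funext fun x => ?_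
    simp [LinearMap.funLeft, mul_assoc]

@[simp] theorem translate_apply (g : G) (f : G → ℝ) (x : G) :
    translate g f x = f (g⁻¹ * x) := rfl

/-- The convex hull consists of the random moves by elements of `H`. Linear or convex properties of
such moves need checking only on single translations. -/
theorem mul_mem_convexHull_translate {H : Subgroup G} {P Q : Module.End ℝ (G → ℝ)}
    (hP : P ∈ convexHull ℝ (translate '' (H : Set G)))
    (hQ : Q ∈ convexHull ℝ (translate '' (H : Set G))) :
    P * Q ∈ convexHull ℝ (translate '' (H : Set G)) := by
  have h1 : ∀ g ∈ H, translate g * Q ∈ convexHull ℝ (translate '' (H : Set G)) := by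
    intro g hg
    have : convexHull ℝ (translate '' (H : Set G)) ⊆
        (LinearMap.mulLeft ℝ (translate g)) ⁻¹' convexHull ℝ (translate '' (H : Set G)) := by
      refine convexHull_min ?_ ((convex_convexHull ℝ _).linear_preimage _)
      rintro _ ⟨h, hh, rfl⟩
      exact subset_convexHull ℝ _ ⟨g * h, H.mul_mem hg hh, by simp⟩
    exact this hQ
  have : convexHull ℝ (translate '' (H : Set G)) ⊆
      (LinearMap.mulRight ℝ Q) ⁻¹' convexHull ℝ (translate '' (H : Set G)) := by
    refine convexHull_min ?_ ((convex_convexHull ℝ _).linear_preimage _)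
    rintro _ ⟨h, hh, rfl⟩
    exact h1 h hh
  exact this hP

theorem mul_eq_of_mem_convexHull_translate {H : Subgroup G} {W Q : Module.End ℝ (G → ℝ)}
    (hW : ∀ h ∈ H, W * translate h = W) (hQ : Q ∈ convexHull ℝ (translate '' (H : Set G))) :
    W * Q = W := by
  have : convexHull ℝ (translate '' (H : Set G)) ⊆ (LinearMap.mulLeft ℝ W) ⁻¹' {W} := by
    refine convexHull_min ?_ ((convex_singleton W).linear_preimage _)
    rintro _ ⟨h, hh, rfl⟩
    exact hW h hh
  exact this hQ

theorem commute_of_mem_convexHull_translate {H : Subgroup G} {W Q : Module.End ℝ (G → ℝ)}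
    (hW : ∀ h ∈ H, Commute W (translate h)) (hQ : Q ∈ convexHull ℝ (translate '' (H : Set G))) :
    Commute W Q := by
  have : convexHull ℝ (translate '' (H : Set G)) ⊆
      (LinearMap.mulLeft ℝ W - LinearMap.mulRight ℝ W) ⁻¹' {0} := by
    refine convexHull_min ?_ ((convex_singleton _).linear_preimage _)
    rintro _ ⟨h, hh, rfl⟩
    simpa [sub_eq_zero] using (hW h hh).eq
  have := this hQ
  simpa [sub_eq_zero, Commute, SemiconjBy] using this

theorem nonneg_of_mem_convexHull_translate {H : Subgroup G} {Q : Module.End ℝ (G → ℝ)}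
    (hQ : Q ∈ convexHull ℝ (translate '' (H : Set G))) {f : G → ℝ} (hf : 0 ≤ f) : 0 ≤ Q f := by
  have : convexHull ℝ (translate '' (H : Set G)) ⊆
      (LinearMap.applyₗ (R := ℝ) f : Module.End ℝ (G → ℝ) →ₗ[ℝ] (G → ℝ)) ⁻¹' Set.Ici 0 := by
    refine convexHull_min ?_ ((convex_Ici _).linear_preimage _)
    rintro _ ⟨h, hh, rfl⟩
    exact fun x => hf (h⁻¹ * x)
  exact this hQ

variable [Fintype G]

open Classical in
/-- The average of the left translations by the elements of a subgroup. -/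
noncomputable def subgroupAvg (H : Subgroup G) : Module.End ℝ (G → ℝ) :=
  (Fintype.card H : ℝ)⁻¹ • ∑ h : H, translate (h : G)

theorem translate_mul_subgroupAvg {H : Subgroup G} {h : G} (hh : h ∈ H) :
    translate h * subgroupAvg H = subgroupAvg H := by
  classical
  rw [subgroupAvg, mul_smul_comm, Finset.mul_sum]
  congr 1
  refine Fintype.sum_equiv (Equiv.mulLeft (⟨h, hh⟩ : H)) _ _ fun x => ?_
  simp

theorem subgroupAvg_mul_translate {H : Subgroup G} {h : G} (hh : h ∈ H) :
    subgroupAvg H * translate h = subgroupAvg H := by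
  classical
  rw [subgroupAvg, smul_mul_assoc, Finset.sum_mul]
  congr 1
  refine Fintype.sum_equiv (Equiv.mulRight (⟨h, hh⟩ : H)) _ _ fun x => ?_
  simp

theorem mul_subgroupAvg_of_absorb {H : Subgroup G} {W : Module.End ℝ (G → ℝ)}
    (hW : ∀ h ∈ H, W * translate h = W) : W * subgroupAvg H = W := by
  classical
  rw [subgroupAvg, mul_smul_comm, Finset.mul_sum,
    Finset.sum_congr rfl fun (h : H) _ => hW h h.2, Finset.sum_const, Finset.card_univ,
    ← Nat.cast_smul_eq_nsmul ℝ, smul_smul, inv_mul_cancel₀, one_smul]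
  exact_mod_cast Fintype.card_ne_zero

theorem subgroupAvg_mul_of_absorb {H : Subgroup G} {W : Module.End ℝ (G → ℝ)}
    (hW : ∀ h ∈ H, translate h * W = W) : subgroupAvg H * W = W := by
  classical
  rw [subgroupAvg, smul_mul_assoc, Finset.sum_mul,
    Finset.sum_congr rfl fun (h : H) _ => hW h h.2, Finset.sum_const, Finset.card_univ,
    ← Nat.cast_smul_eq_nsmul ℝ, smul_smul, inv_mul_cancel₀, one_smul]
  exact_mod_cast Fintype.card_ne_zero

theorem subgroupAvg_mul_subgroupAvg_of_le {H K : Subgroup G} (h : H ≤ K) :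
    subgroupAvg K * subgroupAvg H = subgroupAvg K :=
  mul_subgroupAvg_of_absorb fun _ hg => subgroupAvg_mul_translate (h hg)

theorem subgroupAvg_bot : subgroupAvg (⊥ : Subgroup G) = 1 := by
  classical
  have := mul_subgroupAvg_of_absorb (H := (⊥ : Subgroup G)) (W := 1) (by
    intro h hh
    rw [Subgroup.mem_bot.1 hh, map_one, one_mul])
  rwa [one_mul] at this

theorem translate_mul_subgroupAvg_conj {H K : Subgroup G} (w : G)
    (hw : ∀ h, h ∈ K ↔ w⁻¹ * h * w ∈ H) :
    translate w * subgroupAvg H = subgroupAvg K * translate w := by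
  have h1 : (subgroupAvg K * translate w) * subgroupAvg H = subgroupAvg K * translate w := by
    refine mul_subgroupAvg_of_absorb fun h hh => ?_
    have : w * h * w⁻¹ ∈ K := by
      rw [hw]
      convert hh using 1
      group
    rw [mul_assoc, ← map_mul, show w * h = w * h * w⁻¹ * w by group, map_mul, ← mul_assoc,
      subgroupAvg_mul_translate this]
  have h2 : subgroupAvg K * (translate w * subgroupAvg H) = translate w * subgroupAvg H := by
    refine subgroupAvg_mul_of_absorb fun h hh => ?_
    rw [← mul_assoc, ← map_mul, show h * w = w * (w⁻¹ * h * w) by group, map_mul, mul_assoc,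
      translate_mul_subgroupAvg ((hw h).1 hh)]
  rw [← h2, ← mul_assoc, h1]

theorem commute_subgroupAvg {H : Subgroup G} {W : Module.End ℝ (G → ℝ)}
    (hW : ∀ h ∈ H, Commute (translate h) W) : Commute (subgroupAvg H) W := by
  classical
  rw [subgroupAvg]
  exact (Commute.sum_left _ _ _ fun (h : H) _ => hW h h.2).smul_left _

/-- Each of the two operators is absorbed by the other, so they agree. This argument recurs wherever
two averages are identified. -/
theorem subgroupAvg_mul_of_commute {H K L : Subgroup G} (hH : H ≤ L) (hK : K ≤ L)
    (hc : ∀ h ∈ H, ∀ k ∈ K, Commute h k) (hL : ∀ g ∈ L, ∃ h ∈ H, ∃ k ∈ K, g = h * k) :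
    subgroupAvg H * subgroupAvg K = subgroupAvg L := by
  have h1 : (subgroupAvg H * subgroupAvg K) * subgroupAvg L = subgroupAvg H * subgroupAvg K := by
    refine mul_subgroupAvg_of_absorb fun g hg => ?_
    obtain ⟨h, hh, k, hk, rfl⟩ := hL g hg
    have hcomm : Commute (subgroupAvg K) (translate h) :=
      commute_subgroupAvg fun k' hk' => ((hc h hh k' hk').map translate).symm
    rw [map_mul, ← mul_assoc, mul_assoc (subgroupAvg H), hcomm.eq, ← mul_assoc,
      subgroupAvg_mul_translate hh, mul_assoc, subgroupAvg_mul_translate hk]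
  have h2 : subgroupAvg H * (subgroupAvg K * subgroupAvg L) = subgroupAvg L := by
    rw [subgroupAvg_mul_of_absorb fun h hh => translate_mul_subgroupAvg (hK hh),
      subgroupAvg_mul_of_absorb fun h hh => translate_mul_subgroupAvg (hH hh)]
  rw [← h1, mul_assoc, h2]

theorem subgroupAvg_mem_convexHull (H : Subgroup G) :
    subgroupAvg H ∈ convexHull ℝ (translate '' (H : Set G)) := by
  classical
  rw [subgroupAvg, Finset.smul_sum]
  refine (convex_convexHull ℝ _).sum_mem (fun _ _ => by positivity) ?_ fun h _ =>
    subset_convexHull ℝ _ ⟨h, h.2, rfl⟩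
  rw [Finset.sum_const, nsmul_eq_mul, Finset.card_univ, mul_inv_cancel₀]
  exact_mod_cast Fintype.card_ne_zero

theorem subgroupAvg_nonneg (H : Subgroup G) {f : G → ℝ} (hf : 0 ≤ f) : 0 ≤ subgroupAvg H f :=
  nonneg_of_mem_convexHull_translate (subgroupAvg_mem_convexHull H) hf

theorem sum_translate_mul (g : G) (f L : G → ℝ) (hL : translate g L = L) :
    ∑ x, translate g f x * L x = ∑ x, f x * L x := by
  refine Fintype.sum_equiv (Equiv.mulLeft g⁻¹) _ _ fun x => ?_
  have := congrFun hL x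
  simp only [translate_apply] at this
  simp [this]

/-- Averaging is a conditional expectation, hence invisible when tested against an invariant
function. -/
theorem sum_subgroupAvg_mul {H : Subgroup G} (f L : G → ℝ)
    (hL : ∀ h ∈ H, translate h L = L) :
    ∑ x, subgroupAvg H f x * L x = ∑ x, f x * L x := by
  let φ : Module.End ℝ (G → ℝ) →ₗ[ℝ] ℝ :=
    (∑ x, L x • LinearMap.proj (R := ℝ) (φ := fun _ : G => ℝ) x) ∘ₗ
      (LinearMap.applyₗ (R := ℝ) f : Module.End ℝ (G → ℝ) →ₗ[ℝ] (G → ℝ))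
  have hφ : ∀ Q, φ Q = ∑ x, Q f x * L x := fun Q => by
    simp [φ, mul_comm]
  have : convexHull ℝ (translate '' (H : Set G)) ⊆ φ ⁻¹' {∑ x, f x * L x} := by
    refine convexHull_min ?_ ((convex_singleton _).linear_preimage _)
    rintro _ ⟨h, hh, rfl⟩
    exact (hφ _).trans (sum_translate_mul h f L (hL h hh))
  exact (hφ _).symm.trans (this (subgroupAvg_mem_convexHull H))

end Translation

/-! ### Inequalities for triangular discrimination, Hellinger distance and entropy -/

section Scalar

/-- The triangular discrimination of two nonnegative numbers. -/
noncomputable def triDisc (a b : ℝ) : ℝ := (a - b) ^ 2 / (a + b)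

theorem triDisc_nonneg {a b : ℝ} (ha : 0 ≤ a) (hb : 0 ≤ b) : 0 ≤ triDisc a b := by
  unfold triDisc; positivity

theorem triDisc_smul {c : ℝ} (a b : ℝ) : triDisc (c * a) (c * b) = c * triDisc a b := by
  unfold triDisc
  rcases eq_or_ne c 0 with rfl | hc
  · simp
  rw [← mul_sub, ← mul_add, mul_pow, pow_two c, mul_assoc, mul_div_mul_left _ _ hc, mul_div_assoc]

/-- This is Cauchy–Schwarz, (x + y)²/(p + q) ≤ x²/p + y²/q. With homogeneity it yields joint
convexity. -/
theorem triDisc_add_le {a b c d : ℝ} (ha : 0 ≤ a) (hb : 0 ≤ b) (hc : 0 ≤ c) (hd : 0 ≤ d) :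
    triDisc (a + c) (b + d) ≤ triDisc a b + triDisc c d := by
  unfold triDisc
  rcases (add_nonneg ha hb).eq_or_lt with h | h
  · obtain rfl : a = 0 := by linarith
    obtain rfl : b = 0 := by linarith
    simp
  rcases (add_nonneg hc hd).eq_or_lt with h' | h'
  · obtain rfl : c = 0 := by linarith
    obtain rfl : d = 0 := by linarith
    simp
  rw [show a + c - (b + d) = (a - b) + (c - d) by ring, show a + c + (b + d) = (a + b) + (c + d) by
    ring, div_add_div _ _ h.ne' h'.ne', div_le_div_iff₀ (by positivity) (by positivity)]
  have key : ((a + b) * (c + d)) * ((a - b) + (c - d)) ^ 2 ≤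
      ((a - b) ^ 2 * (c + d) + (a + b) * (c - d) ^ 2) * ((a + b) + (c + d)) := by
    nlinarith [sq_nonneg ((a - b) * (c + d) - (c - d) * (a + b))]
  linarith

theorem triDisc_sum_le {ι : Type*} (s : Finset ι) (u v : ι → ℝ) (hu : ∀ i ∈ s, 0 ≤ u i)
    (hv : ∀ i ∈ s, 0 ≤ v i) :
    triDisc (∑ i ∈ s, u i) (∑ i ∈ s, v i) ≤ ∑ i ∈ s, triDisc (u i) (v i) := by
  classical
  induction s using Finset.induction_on with
  | empty => simp [triDisc]
  | insert i s hi ih =>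
    simp only [Finset.mem_insert, forall_eq_or_imp] at hu hv
    rw [Finset.sum_insert hi, Finset.sum_insert hi, Finset.sum_insert hi]
    have := ih hu.2 hv.2
    have := triDisc_add_le hu.1 hv.1 (Finset.sum_nonneg hu.2) (Finset.sum_nonneg hv.2)
    linarith

/-- The squared Hellinger distance obeys a triangle inequality up to constants. It is equivalent to
`triDisc` because a + b ≤ (√a + √b)² ≤ 2(a + b). -/
theorem sq_sqrt_sub_sqrt_le_triDisc {a b : ℝ} (ha : 0 ≤ a) (hb : 0 ≤ b) :
    (√a - √b) ^ 2 ≤ triDisc a b := by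
  unfold triDisc
  rcases (add_nonneg ha hb).eq_or_lt with h | h
  · obtain rfl : a = 0 := by linarith
    obtain rfl : b = 0 := by linarith
    simp
  rw [le_div_iff₀ h]
  have h1 := Real.sq_sqrt ha
  have h2 := Real.sq_sqrt hb
  have h3 := Real.sqrt_nonneg a
  have h4 := Real.sqrt_nonneg b
  have : (a - b) ^ 2 = (√a - √b) ^ 2 * (√a + √b) ^ 2 := by
    rw [← mul_pow, ← h1, ← h2]; simp; ring
  rw [this]
  refine mul_le_mul_of_nonneg_left ?_ (sq_nonneg _)
  nlinarith [mul_nonneg h3 h4]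

theorem triDisc_le_sq_sqrt_sub_sqrt {a b : ℝ} (ha : 0 ≤ a) (hb : 0 ≤ b) :
    triDisc a b ≤ 2 * (√a - √b) ^ 2 := by
  unfold triDisc
  rcases (add_nonneg ha hb).eq_or_lt with h | h
  · obtain rfl : a = 0 := by linarith
    obtain rfl : b = 0 := by linarith
    simp
  rw [div_le_iff₀ h]
  have h1 := Real.sq_sqrt ha
  have h2 := Real.sq_sqrt hb
  have : (a - b) ^ 2 = (√a - √b) ^ 2 * (√a + √b) ^ 2 := by
    rw [← mul_pow, ← h1, ← h2]; simp; ring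
  rw [this, mul_comm 2, mul_assoc]
  refine mul_le_mul_of_nonneg_left ?_ (sq_nonneg _)
  nlinarith [sq_nonneg (√a - √b)]

theorem sq_sqrt_sub_sqrt_le_mul_log {a s : ℝ} (ha : 0 ≤ a) (hs : 0 < s) :
    (√a - √s) ^ 2 ≤ a * Real.log a - a * Real.log s - a + s := by
  rcases ha.eq_or_lt with rfl | ha
  · simp [Real.sq_sqrt hs.le]
  have h1 := Real.sq_sqrt ha.le
  have h2 := Real.sq_sqrt hs.le
  have h3 := Real.sqrt_pos.2 ha
  have h4 := Real.sqrt_pos.2 hs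
  have hl := Real.log_le_sub_one_of_pos (div_pos h4 h3)
  rw [Real.log_div h4.ne' h3.ne', Real.log_sqrt ha.le, Real.log_sqrt hs.le] at hl
  have : a * (Real.log s / 2 - Real.log a / 2) ≤ a * (√s / √a - 1) :=
    mul_le_mul_of_nonneg_left hl ha.le
  have h5 : a * (√s / √a) = √a * √s := by
    field_simp; rw [h1]
  nlinarith

/-- The entropy lost by averaging two numbers. -/
theorem triDisc_le_jensen {a b : ℝ} (ha : 0 ≤ a) (hb : 0 ≤ b) :
    triDisc a b / 8 ≤ (a * Real.log a + b * Real.log b) / 2 -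
      (a + b) / 2 * Real.log ((a + b) / 2) := by
  rcases (add_nonneg ha hb).eq_or_lt with h | h
  · obtain rfl : a = 0 := by linarith
    obtain rfl : b = 0 := by linarith
    simp [triDisc]
  have hs : 0 < (a + b) / 2 := by linarith
  set s := (a + b) / 2 with hs_def
  have h1 := sq_sqrt_sub_sqrt_le_mul_log ha hs
  have h2 := sq_sqrt_sub_sqrt_le_mul_log hb hs
  have h3 := triDisc_le_sq_sqrt_sub_sqrt ha hs.le
  have h4 := triDisc_le_sq_sqrt_sub_sqrt hb hs.le
  -- Passing from a to b through the midpoint: the pairs (a, s) and (s, b) add up to (a + s, b + s),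
  -- with the same difference as (a, b) and twice the sum.
  have h5 : triDisc a b ≤ 2 * (triDisc a s + triDisc b s) := by
    have h6 : triDisc a b = triDisc (a + s) (b + s) * 2 := by
      unfold triDisc
      rw [show a + s + (b + s) = 2 * (a + b) by rw [hs_def]; ring]
      field_simp
      ring
    have h7 := triDisc_add_le ha hs.le hs.le hb
    have h8 : triDisc s b = triDisc b s := by
      unfold triDisc; ring
    rw [h6, add_comm b s]
    linarith
  have h6 : a * Real.log s + b * Real.log s = 2 * (s * Real.log s) := by
    rw [hs_def]; ring
  have h7 : a + b = 2 * s := by rw [hs_def]; ring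
  linarith

/-- For w ≤ 3u the bound log x ≤ x - 1 gives a chi-square term, and w + u ≤ 4u. For w ≥ 3u the
logarithm is at most log n, and w(w + u) ≤ 3(w - u)². -/
theorem mul_log_le_triDisc {n w u : ℝ} (hn : 1 ≤ n) (hw : 0 ≤ w) (hu : 0 ≤ u) (hwu : w ≤ n * u) :
    w * Real.log w - w * Real.log u - w + u ≤ (4 + 3 * Real.log n) * triDisc w u := by
  rcases hu.eq_or_lt with rfl | hu
  · obtain rfl : w = 0 := by linarith
    simp [triDisc]
  rcases hw.eq_or_lt with rfl | hw
  · have := Real.log_nonneg hn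
    have h2 : triDisc 0 u = u := by
      unfold triDisc; field_simp; ring
    rw [h2]; nlinarith
  have hln := Real.log_nonneg hn
  have hlog : w * Real.log w - w * Real.log u = w * Real.log (w / u) := by
    rw [Real.log_div hw.ne' hu.ne']; ring
  rw [hlog]
  unfold triDisc
  rw [← mul_div_assoc, le_div_iff₀ (by positivity)]
  rcases le_total w (3 * u) with h | h
  · have h1 := Real.log_le_sub_one_of_pos (div_pos hw hu)
    have h2 : w * Real.log (w / u) - w + u ≤ (w - u) ^ 2 / u := by
      have : (w - u) ^ 2 / u = w * (w / u - 1) - w + u := by field_simp; ring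
      rw [this]
      have := mul_le_mul_of_nonneg_left h1 hw.le
      linarith
    calc _ ≤ (w - u) ^ 2 / u * (w + u) := mul_le_mul_of_nonneg_right h2 (by positivity)
      _ ≤ (w - u) ^ 2 / u * (4 * u) := mul_le_mul_of_nonneg_left (by linarith) (by positivity)
      _ = 4 * (w - u) ^ 2 := by field_simp
      _ ≤ _ := mul_le_mul_of_nonneg_right (by linarith) (sq_nonneg _)
  · have h1 : Real.log (w / u) ≤ Real.log n :=
      Real.log_le_log (by positivity) (by rwa [div_le_iff₀ hu])
    have h2 : w * Real.log (w / u) - w + u ≤ w * Real.log n := by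
      have := mul_le_mul_of_nonneg_left h1 hw.le
      linarith
    calc _ ≤ w * Real.log n * (w + u) := mul_le_mul_of_nonneg_right h2 (by positivity)
      _ = Real.log n * (w * (w + u)) := by ring
      _ ≤ Real.log n * (3 * (w - u) ^ 2) :=
          mul_le_mul_of_nonneg_left (by nlinarith) hln
      _ ≤ _ := by nlinarith [sq_nonneg (w - u)]

/-- Comparison of the discrimination to the mean over `A ∪ B` with that to the mean over `B`. -/
theorem sum_triDisc_mean_le {ι : Type*} [DecidableEq ι] {A B : Finset ι} (hAB : Disjoint A B)
    (hB : B.Nonempty) (w : ι → ℝ) (hw : ∀ i, 0 ≤ w i) :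
    ∑ k ∈ A, triDisc (w k) ((((A ∪ B).card : ℝ))⁻¹ * ∑ x ∈ A ∪ B, w x) ≤
      8 * ∑ k ∈ A, triDisc (w k) ((B.card : ℝ)⁻¹ * ∑ b ∈ B, w b) := by
  rcases A.eq_empty_or_nonempty with rfl | hA
  · simp
  set q := (B.card : ℝ)⁻¹ * ∑ b ∈ B, w b with hq
  set a := (A.card : ℝ)⁻¹ * ∑ b ∈ A, w b with ha
  set u := (((A ∪ B).card : ℝ))⁻¹ * ∑ x ∈ A ∪ B, w x with hu
  have hcA : (0 : ℝ) < A.card := by exact_mod_cast hA.card_pos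
  have hcB : (0 : ℝ) < B.card := by exact_mod_cast hB.card_pos
  clear_value q a u
  have hq0 : 0 ≤ q := hq ▸ mul_nonneg (by positivity) (Finset.sum_nonneg fun i _ => hw i)
  have ha0 : 0 ≤ a := ha ▸ mul_nonneg (by positivity) (Finset.sum_nonneg fun i _ => hw i)
  have hu0 : 0 ≤ u := hu ▸ mul_nonneg (by positivity) (Finset.sum_nonneg fun i _ => hw i)
  have hsA : ∑ b ∈ A, w b = A.card * a := by rw [ha, mul_inv_cancel_left₀ hcA.ne']
  have hsB : ∑ b ∈ B, w b = B.card * q := by rw [hq, mul_inv_cancel_left₀ hcB.ne']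
  have hum : u = (A.card * a + B.card * q) / (A.card + B.card) := by
    rw [hu, Finset.sum_union hAB, Finset.card_union_of_disjoint hAB, hsA, hsB]
    rw [Nat.cast_add, inv_mul_eq_div]
  have hcAB : (0 : ℝ) < A.card + B.card := add_pos hcA hcB
  -- The mean over the union lies between the means over the two parts.
  have hsq : (√q - √u) ^ 2 ≤ (√q - √a) ^ 2 := by
    rcases le_total a q with h | h
    · have h1 : a ≤ u := by rw [hum, le_div_iff₀ hcAB]; nlinarith
      have h2 : u ≤ q := by rw [hum, div_le_iff₀ hcAB]; nlinarith
      have := Real.sqrt_le_sqrt h1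
      have := Real.sqrt_le_sqrt h2
      exact pow_le_pow_left₀ (by linarith) (by linarith) 2
    · have h1 : u ≤ a := by rw [hum, div_le_iff₀ hcAB]; nlinarith
      have h2 : q ≤ u := by rw [hum, le_div_iff₀ hcAB]; nlinarith
      have := Real.sqrt_le_sqrt h1
      have := Real.sqrt_le_sqrt h2
      nlinarith
  have hmean : A.card * (√q - √a) ^ 2 ≤ ∑ k ∈ A, triDisc (w k) q := by
    calc A.card * (√q - √a) ^ 2 ≤ A.card * triDisc a q := by
          have := sq_sqrt_sub_sqrt_le_triDisc ha0 hq0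
          rw [show (√q - √a) ^ 2 = (√a - √q) ^ 2 by ring]
          exact mul_le_mul_of_nonneg_left this hcA.le
      _ = triDisc (∑ k ∈ A, w k) (∑ k ∈ A, q) := by
          rw [hsA, Finset.sum_const, nsmul_eq_mul, triDisc_smul]
      _ ≤ _ := triDisc_sum_le A w (fun _ => q) (fun i _ => hw i) fun _ _ => hq0
  -- The factor 4 is 2 from the Hellinger comparison times 2 from (x + y)² ≤ 2x² + 2y².
  have hpt : ∀ k ∈ A, triDisc (w k) u ≤ 4 * triDisc (w k) q + 4 * (√q - √a) ^ 2 := by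
    intro k _
    have h1 := triDisc_le_sq_sqrt_sub_sqrt (hw k) hu0
    have h2 := sq_sqrt_sub_sqrt_le_triDisc (hw k) hq0
    nlinarith [sq_nonneg ((√(w k) - √q) - (√q - √u))]
  calc _ ≤ ∑ k ∈ A, (4 * triDisc (w k) q + 4 * (√q - √a) ^ 2) := Finset.sum_le_sum hpt
    _ = 4 * ∑ k ∈ A, triDisc (w k) q + 4 * (A.card * (√q - √a) ^ 2) := by
        rw [Finset.sum_add_distrib, ← Finset.mul_sum, Finset.sum_const, nsmul_eq_mul]; ring
    _ ≤ _ := by linarith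

end Scalar

/-! ### Entropy and discrimination of functions on a group -/

section Functionals

variable {G : Type*} [Group G] [Fintype G]

/-- The sum of `f log f`. -/
noncomputable def entropySum (f : G → ℝ) : ℝ := ∑ x, f x * Real.log (f x)

/-- The triangular discrimination of two nonnegative functions. -/
noncomputable def triDiscSum (f h : G → ℝ) : ℝ := ∑ x, triDisc (f x) (h x)

theorem translate_nonneg (g : G) {f : G → ℝ} (hf : 0 ≤ f) : 0 ≤ translate g f :=
  fun x => hf (g⁻¹ * x)

theorem entropySum_translate (g : G) (f : G → ℝ) :
    entropySum (translate g f) = entropySum f :=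
  Fintype.sum_equiv (Equiv.mulLeft g⁻¹) _ _ fun _ => rfl

theorem triDiscSum_translate (g : G) (f h : G → ℝ) :
    triDiscSum (translate g f) (translate g h) = triDiscSum f h :=
  Fintype.sum_equiv (Equiv.mulLeft g⁻¹) _ _ fun _ => rfl

theorem triDiscSum_nonneg {f h : G → ℝ} (hf : 0 ≤ f) (hh : 0 ≤ h) : 0 ≤ triDiscSum f h :=
  Finset.sum_nonneg fun x _ => triDisc_nonneg (hf x) (hh x)

/-- Data processing: joint convexity together with translation invariance. -/
theorem triDiscSum_subgroupAvg_le (H : Subgroup G) {f h : G → ℝ} (hf : 0 ≤ f) (hh : 0 ≤ h) :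
    triDiscSum (subgroupAvg H f) (subgroupAvg H h) ≤ triDiscSum f h := by
  classical
  have hE : ∀ (f : G → ℝ) x, subgroupAvg H f x =
      (Fintype.card H : ℝ)⁻¹ * ∑ g : H, translate (g : G) f x := fun f x => by
    simp [subgroupAvg]
  calc triDiscSum (subgroupAvg H f) (subgroupAvg H h)
      ≤ ∑ x, (Fintype.card H : ℝ)⁻¹ *
          ∑ g : H, triDisc (translate (g : G) f x) (translate (g : G) h x) := by
        refine Finset.sum_le_sum fun x _ => ?_
        rw [hE, hE, triDisc_smul]
        refine mul_le_mul_of_nonneg_left ?_ (by positivity)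
        exact triDisc_sum_le _ _ _ (fun g _ => hf _) fun g _ => hh _
    _ = (Fintype.card H : ℝ)⁻¹ * ∑ g : H, triDiscSum (translate (g : G) f)
          (translate (g : G) h) := by
        rw [← Finset.mul_sum, Finset.sum_comm]; rfl
    _ = triDiscSum f h := by
        simp_rw [triDiscSum_translate]
        rw [Finset.sum_const, nsmul_eq_mul, Finset.card_univ, inv_mul_cancel_left₀]
        exact_mod_cast Fintype.card_ne_zero

theorem triDiscSum_mean_le {ι : Type*} {B : Finset ι} (hB : B.Nonempty) {u : G → ℝ}
    {v : ι → G → ℝ} (hu : 0 ≤ u) (hv : ∀ b, 0 ≤ v b) :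
    B.card * triDiscSum u ((B.card : ℝ)⁻¹ • ∑ b ∈ B, v b) ≤ ∑ b ∈ B, triDiscSum u (v b) := by
  have hc : (B.card : ℝ) ≠ 0 := by exact_mod_cast hB.card_pos.ne'
  unfold triDiscSum
  rw [Finset.mul_sum, Finset.sum_comm]
  refine Finset.sum_le_sum fun x _ => ?_
  rw [← triDisc_smul]
  have := triDisc_sum_le B (fun _ => u x) (fun b => v b x) (fun _ _ => hu x) fun b _ => hv b x
  simpa [hc] using this

theorem convexOn_entropySum : ConvexOn ℝ {f : G → ℝ | 0 ≤ f} entropySum := by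
  refine ⟨convex_Ici _, fun f hf h hh a b ha hb hab => ?_⟩
  unfold entropySum
  rw [Finset.smul_sum, Finset.smul_sum, ← Finset.sum_add_distrib]
  exact Finset.sum_le_sum fun x _ => Real.convexOn_mul_log.2 (hf x) (hh x) ha hb hab

theorem entropySum_mean_le {ι : Type*} {s : Finset ι} (hs : s.Nonempty) {v : ι → G → ℝ}
    (hv : ∀ i, 0 ≤ v i) :
    entropySum ((s.card : ℝ)⁻¹ • ∑ i ∈ s, v i) ≤ (s.card : ℝ)⁻¹ * ∑ i ∈ s, entropySum (v i) := by
  rw [Finset.smul_sum, Finset.mul_sum]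
  refine convexOn_entropySum.map_sum_le (fun _ _ => by positivity) ?_ fun i _ => hv i
  rw [Finset.sum_const, nsmul_eq_mul, mul_inv_cancel₀]
  exact_mod_cast hs.card_pos.ne'

/-- Sublevel sets of entropy are convex, so a bound valid for every deterministic move holds for a
random one. -/
theorem entropySum_le_of_mem_convexHull {H : Subgroup G} {K Q : Module.End ℝ (G → ℝ)} {χ : G → ℝ}
    {b : ℝ} (hK : ∀ f, 0 ≤ f → 0 ≤ K f) (hχ : 0 ≤ χ)
    (hb : ∀ g ∈ H, entropySum (K (translate g χ)) ≤ b)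
    (hQ : Q ∈ convexHull ℝ (translate '' (H : Set G))) : entropySum (K (Q χ)) ≤ b := by
  have : convexHull ℝ (translate '' (H : Set G)) ⊆
      (K ∘ₗ (LinearMap.applyₗ (R := ℝ) χ : Module.End ℝ (G → ℝ) →ₗ[ℝ] (G → ℝ))) ⁻¹'
        {f ∈ {f : G → ℝ | 0 ≤ f} | entropySum f ≤ b} := by
    refine convexHull_min ?_ ((convexOn_entropySum.convex_le b).linear_preimage _)
    rintro _ ⟨h, hh, rfl⟩
    exact ⟨hK _ fun x => hχ (h⁻¹ * x), hb h hh⟩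
  exact (this hQ).2

/-- The average of the identity and the translation by `g`. -/
noncomputable def lazyTranslate (g : G) : Module.End ℝ (G → ℝ) := (2⁻¹ : ℝ) • (1 + translate g)

theorem triDiscSum_le_entropySum_sub (g : G) {f : G → ℝ} (hf : 0 ≤ f) :
    triDiscSum f (translate g f) / 8 ≤ entropySum f - entropySum (lazyTranslate g f) := by
  have h1 : entropySum f - entropySum (lazyTranslate g f) =
      ∑ x, ((f x * Real.log (f x) + translate g f x * Real.log (translate g f x)) / 2 -
        (f x + translate g f x) / 2 * Real.log ((f x + translate g f x) / 2)) := by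
    have h2 : entropySum f = (entropySum f + entropySum (translate g f)) / 2 := by
      rw [entropySum_translate]; ring
    rw [Finset.sum_sub_distrib, ← Finset.sum_div, Finset.sum_add_distrib, h2]
    congr 1
    refine Finset.sum_congr rfl fun x _ => ?_
    have : lazyTranslate g f x = (f x + translate g f x) / 2 := by
      simp only [lazyTranslate, LinearMap.smul_apply, LinearMap.add_apply, Module.End.one_apply,
        Pi.smul_apply, Pi.add_apply, smul_eq_mul]
      ring
    rw [this]
  rw [h1, triDiscSum, Finset.sum_div]
  exact Finset.sum_le_sum fun x _ => triDisc_le_jensen (hf x) (hf _)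

end Functionals

/-! ### Forgetting cards, and the conditional law of one card -/

section Perms

open Equiv

variable {X : Type*} [Fintype X] [DecidableEq X]

/-- The permutations which fix all points outside `T`. -/
def permsOn (T : Finset X) : Subgroup (Perm X) where
  carrier := {g | ∀ x ∉ T, g x = x}
  one_mem' _ _ := rfl
  mul_mem' := fun {g h} hg hh x hx => by rw [Perm.mul_apply, hh x hx, hg x hx]
  inv_mem' := fun {g} hg x hx => by rw [Perm.inv_eq_iff_eq, hg x hx]

theorem mem_permsOn {T : Finset X} {g : Perm X} : g ∈ permsOn T ↔ ∀ x ∉ T, g x = x := Iff.rfl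

theorem permsOn_mono {S T : Finset X} (h : S ⊆ T) : permsOn S ≤ permsOn T :=
  fun _ hg x hx => hg x fun hx' => hx (h hx')

theorem apply_mem_of_mem_permsOn {T : Finset X} {g : Perm X} (hg : g ∈ permsOn T) {x : X} :
    g x ∈ T ↔ x ∈ T := by
  constructor
  · intro h
    by_contra hx
    exact hx (hg x hx ▸ h)
  · intro h
    by_contra hx
    have := hg _ hx
    rw [g.injective this] at hx
    exact hx h

theorem swap_mem_permsOn {T : Finset X} {a b : X} (ha : a ∈ T) (hb : b ∈ T) :
    swap a b ∈ permsOn T := fun _ hx =>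
  swap_apply_of_ne_of_ne (fun h => hx (h ▸ ha)) fun h => hx (h ▸ hb)

theorem commute_of_mem_permsOn {S T : Finset X} (hST : Disjoint S T) {g h : Perm X}
    (hg : g ∈ permsOn S) (hh : h ∈ permsOn T) : Commute g h := by
  refine Perm.Disjoint.commute fun x => ?_
  by_cases hx : x ∈ S
  · exact Or.inr (hh x (Finset.disjoint_left.1 hST hx))
  · exact Or.inl (hg x hx)

/-- The average over the permutations of the positions in `T`: the conditional expectation given
the cards outside `T`. -/
noncomputable def forget (T : Finset X) : Module.End ℝ (Perm X → ℝ) := subgroupAvg (permsOn T)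

/-- Once the positions of `T` other than `k` are forgotten, a permutation of `T` matters only
through the position that it carries to `k`. -/
theorem forget_erase_mul_translate {T : Finset X} {k x : X} {g h : Perm X}
    (hg : g ∈ permsOn T) (hh : h ∈ permsOn T) (hgx : g x = k) (hhx : h x = k) :
    forget (T.erase k) * translate g = forget (T.erase k) * translate h := by
  have : g * h⁻¹ ∈ permsOn (T.erase k) := by
    intro y hy
    by_cases hyk : y = k
    · subst hyk
      rw [Perm.mul_apply, Perm.inv_eq_iff_eq.2 hhx.symm, hgx]
    · exact (permsOn T).mul_mem hg ((permsOn T).inv_mem hh) y fun h' =>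
        hy (Finset.mem_erase.2 ⟨hyk, h'⟩)
  rw [show g = g * h⁻¹ * h by group, map_mul, ← mul_assoc, forget,
    subgroupAvg_mul_translate this]

/-- Coset decomposition: choose the position whose card comes to `k`, then permute the rest of `T`.
-/
theorem forget_eq_mean {T : Finset X} {k : X} (hk : k ∈ T) :
    forget T = (T.card : ℝ)⁻¹ • ∑ x ∈ T, forget (T.erase k) * translate (swap k x) := by
  have hc : (T.card : ℝ) ≠ 0 := by exact_mod_cast (Finset.card_pos.2 ⟨k, hk⟩).ne'
  set W := (T.card : ℝ)⁻¹ • ∑ x ∈ T, forget (T.erase k) * translate (swap k x) with hW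
  have h1 : W * forget T = W := by
    refine mul_subgroupAvg_of_absorb fun g hg => ?_
    rw [hW, smul_mul_assoc, Finset.sum_mul]
    congr 1
    refine Finset.sum_nbij' (fun x => g⁻¹ x) (fun x => g x) ?_ ?_ ?_ ?_ ?_
    · exact fun x hx => (apply_mem_of_mem_permsOn ((permsOn T).inv_mem hg)).2 hx
    · exact fun x hx => (apply_mem_of_mem_permsOn hg).2 hx
    · simp
    · simp
    · intro x hx
      have hx' := (apply_mem_of_mem_permsOn ((permsOn T).inv_mem hg)).2 hx
      rw [mul_assoc, ← map_mul]
      exact forget_erase_mul_translate (x := g⁻¹ x)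
        ((permsOn T).mul_mem (swap_mem_permsOn hk hx) hg) (swap_mem_permsOn hk hx')
        (by simp) (by simp)
  have h2 : W * forget T = forget T := by
    rw [hW, smul_mul_assoc, Finset.sum_mul]
    have : ∀ x ∈ T, forget (T.erase k) * translate (swap k x) * forget T = forget T := by
      intro x hx
      rw [mul_assoc, forget, forget, translate_mul_subgroupAvg (swap_mem_permsOn hk hx)]
      exact subgroupAvg_mul_of_absorb fun h hh =>
        translate_mul_subgroupAvg (permsOn_mono (Finset.erase_subset _ _) hh)
    rw [Finset.sum_congr rfl this, Finset.sum_const, ← Nat.cast_smul_eq_nsmul ℝ, smul_smul,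
      inv_mul_cancel₀ hc, one_smul]
  rw [← h2, h1]

theorem forget_nonneg (T : Finset X) {f : Perm X → ℝ} (hf : 0 ≤ f) : 0 ≤ forget T f :=
  subgroupAvg_nonneg _ hf

/-- The left side is the term x = k of a mean of nonnegative terms. This is the density bound
required by `mul_log_le_triDisc`. -/
theorem forget_erase_le {T : Finset X} {k : X} (hk : k ∈ T) {f : Perm X → ℝ} (hf : 0 ≤ f)
    (x : Perm X) : forget (T.erase k) f x ≤ T.card * forget T f x := by
  have hc : (T.card : ℝ) ≠ 0 := by exact_mod_cast (Finset.card_pos.2 ⟨k, hk⟩).ne'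
  rw [forget_eq_mean hk]
  simp only [LinearMap.smul_apply, LinearMap.sum_apply, Pi.smul_apply, Finset.sum_apply,
    smul_eq_mul]
  rw [mul_inv_cancel_left₀ hc]
  have h : (forget (T.erase k) * translate (swap k k)) f x = forget (T.erase k) f x := by
    rw [swap_self, ← Perm.one_def, map_one, mul_one]
  rw [← h]
  exact Finset.single_le_sum (f := fun y => (forget (T.erase k) * translate (swap k y)) f x)
    (fun y _ => forget_nonneg (T.erase k) (translate_nonneg (swap k y) hf) x) hk

/-- The entropy of the card at position `k` given the cards outside `T`. -/
theorem entropySum_forget_erase_sub_le {T : Finset X} {k : X} (hk : k ∈ T) {f : Perm X → ℝ}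
    (hf : 0 ≤ f) :
    entropySum (forget (T.erase k) f) - entropySum (forget T f) ≤
      (4 + 3 * Real.log T.card) * triDiscSum (forget (T.erase k) f) (forget T f) := by
  set w := forget (T.erase k) f
  set u := forget T f with hu_def
  have hu : ∀ g ∈ permsOn T, translate g u = u := fun g hg => by
    rw [hu_def, ← Module.End.mul_apply, forget, translate_mul_subgroupAvg hg]
  -- Functions of `u` are invariant under `permsOn T`, so they cannot distinguish `u` from `w`.
  -- Hence the entropy difference is a relative entropy, to which the terms -w + u contribute zero.
  have hsum : ∀ φ : ℝ → ℝ, ∑ x, u x * φ (u x) = ∑ x, w x * φ (u x) := by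
    intro φ
    have hφ : ∀ g ∈ permsOn T, translate g (fun x => φ (u x)) = fun x => φ (u x) := fun g hg => by
      conv_rhs => rw [← hu g hg]
      rfl
    exact (sum_subgroupAvg_mul f (fun x => φ (u x)) hφ).trans
      (sum_subgroupAvg_mul f (fun x => φ (u x)) fun g hg =>
        hφ g (permsOn_mono (Finset.erase_subset _ _) hg)).symm
  have h1 : entropySum w - entropySum u =
      ∑ x, (w x * Real.log (w x) - w x * Real.log (u x) - w x + u x) := by
    have h2 := hsum Real.log
    have h3 := hsum fun _ => 1
    simp only [mul_one] at h3
    simp only [Finset.sum_add_distrib, Finset.sum_sub_distrib, entropySum]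
    linarith
  rw [h1, triDiscSum, Finset.mul_sum]
  refine Finset.sum_le_sum fun x _ => mul_log_le_triDisc ?_ ?_ ?_ ?_
  · exact_mod_cast Finset.card_pos.2 ⟨k, hk⟩
  · exact forget_nonneg _ hf x
  · exact forget_nonneg _ hf x
  · exact forget_erase_le hk hf x

/-- Translation by `swap k₀ k` carries the comparison at each `k` to one reference position `k₀`.
There all `k` share the same family `w`, and `sum_triDisc_mean_le` applies pointwise. -/
theorem sum_triDiscSum_forget_le {A B : Finset X} (hAB : Disjoint A B) (hB : B.Nonempty)
    {f : Perm X → ℝ} (hf : 0 ≤ f) :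
    ∑ k ∈ A, triDiscSum (forget ((A ∪ B).erase k) f) (forget (A ∪ B) f) ≤
      8 * ∑ k ∈ A, triDiscSum (forget ((A ∪ B).erase k) f) ((B.card : ℝ)⁻¹ • ∑ b ∈ B,
        forget ((A ∪ B).erase k) (translate (swap k b) f)) := by
  rcases A.eq_empty_or_nonempty with rfl | ⟨k₀, hk₀⟩
  · simp
  set T := A ∪ B with hT
  have hAT : A ⊆ T := Finset.subset_union_left
  have hBT : B ⊆ T := Finset.subset_union_right
  set w : X → Perm X → ℝ := fun x => forget (T.erase k₀) (translate (swap k₀ x) f) with hw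
  have hw0 : ∀ x, 0 ≤ w x := fun x => forget_nonneg _ (translate_nonneg _ hf)
  have hx : ∀ k ∈ T, ∀ x ∈ T, forget (T.erase k) (translate (swap k x) f) =
      translate (swap k₀ k) (w x) := by
    intro k hk x hx
    have h1 : translate (swap k₀ k) * forget (T.erase k₀) =
        forget (T.erase k) * translate (swap k₀ k) := by
      refine translate_mul_subgroupAvg_conj _ fun h => ?_
      simp only [mem_permsOn, Finset.mem_erase, not_and, swap_inv, Perm.mul_apply]
      have hmem : ∀ y, swap k₀ k y ∈ T ↔ y ∈ T := fun y =>
        apply_mem_of_mem_permsOn (swap_mem_permsOn (hAT hk₀) hk)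
      constructor
      · intro H y hy
        rw [H (swap k₀ k y) (fun h' => by
          rw [hmem]; exact hy fun h'' => h' (by rw [h'', swap_apply_left])), swap_apply_self]
      · intro H y hy
        have := H (swap k₀ k y) (fun h' => by
          rw [hmem]; exact hy fun h'' => h' (by rw [h'', swap_apply_right]))
        rw [swap_apply_self] at this
        exact (swap k₀ k).injective this
    have h2 := forget_erase_mul_translate (T := T) (k := k) (x := x)
      (swap_mem_permsOn hk hx)
      ((permsOn T).mul_mem (swap_mem_permsOn (hAT hk₀) hk) (swap_mem_permsOn (hAT hk₀) hx))
      (by simp) (by simp)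
    calc forget (T.erase k) (translate (swap k x) f)
        = (forget (T.erase k) * translate (swap k x)) f := rfl
      _ = (translate (swap k₀ k) * forget (T.erase k₀) * translate (swap k₀ x)) f := by
          rw [h2, map_mul, h1, mul_assoc]
      _ = _ := rfl
  have hU : forget T f = (T.card : ℝ)⁻¹ • ∑ x ∈ T, w x := by
    rw [forget_eq_mean (hAT hk₀)]
    simp [hw]
  have hl : ∀ k ∈ A, triDiscSum (forget (T.erase k) f) (forget T f) =
      triDiscSum (w k) ((T.card : ℝ)⁻¹ • ∑ x ∈ T, w x) := by
    intro k hk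
    have h1 := hx k (hAT hk) k (hAT hk)
    rw [swap_self, ← Perm.one_def, map_one, Module.End.one_apply] at h1
    have h2 : forget T f = translate (swap k₀ k) (forget T f) := by
      rw [← Module.End.mul_apply, forget,
        translate_mul_subgroupAvg (swap_mem_permsOn (hAT hk₀) (hAT hk))]
    rw [h1, h2, triDiscSum_translate, hU]
  have hr : ∀ k ∈ A, triDiscSum (forget (T.erase k) f) ((B.card : ℝ)⁻¹ • ∑ b ∈ B,
        forget (T.erase k) (translate (swap k b) f)) =
      triDiscSum (w k) ((B.card : ℝ)⁻¹ • ∑ x ∈ B, w x) := by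
    intro k hk
    have h1 := hx k (hAT hk) k (hAT hk)
    rw [swap_self, ← Perm.one_def, map_one, Module.End.one_apply] at h1
    rw [h1, Finset.sum_congr rfl fun b hb => hx k (hAT hk) b (hBT hb), ← map_sum, ← map_smul,
      triDiscSum_translate]
  rw [Finset.sum_congr rfl hl, Finset.sum_congr rfl hr]
  unfold triDiscSum
  rw [Finset.sum_comm, Finset.sum_comm (s := A), Finset.mul_sum]
  refine Finset.sum_le_sum fun x _ => ?_
  have := sum_triDisc_mean_le hAB hB (fun i => w i x) fun i => hw0 i x
  simpa using this

end Perms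

/-! ### Switches along a random matching -/

section Edges

open Equiv

variable {X : Type*} [Fintype X] [DecidableEq X]

/-- The permutations which move points of `Y` within their cycles of `θ` and fix all other points.
If `θ` is an involution, the cycles are the edges `{x, θ x}`. -/
def edgeGroup (θ : Perm X) (Y : Finset X) : Subgroup (Perm X) where
  carrier := {g | (∀ x, θ.SameCycle x (g x)) ∧ ∀ x ∉ Y, g x = x}
  one_mem' := ⟨fun _ => Perm.SameCycle.refl _ _, fun _ _ => rfl⟩
  mul_mem' := fun {g h} hg hh =>
    ⟨fun x => (hh.1 x).trans (hg.1 (h x)), (permsOn Y).mul_mem hg.2 hh.2⟩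
  inv_mem' := fun {g} hg =>
    ⟨fun x => by simpa using (hg.1 (g⁻¹ x)).symm, (permsOn Y).inv_mem hg.2⟩

theorem mem_edgeGroup {θ : Perm X} {Y : Finset X} {g : Perm X} :
    g ∈ edgeGroup θ Y ↔ (∀ x, θ.SameCycle x (g x)) ∧ ∀ x ∉ Y, g x = x := Iff.rfl

theorem edgeGroup_le_permsOn (θ : Perm X) (Y : Finset X) : edgeGroup θ Y ≤ permsOn Y :=
  fun _ hg => hg.2

theorem sameCycle_iff_of_involutive {θ : Perm X} (hθ : Function.Involutive θ) {x y : X} :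
    θ.SameCycle x y ↔ y = x ∨ y = θ x := by
  have h2 : θ ^ (2 : ℤ) = 1 := by
    ext z
    exact hθ z
  constructor
  · rintro ⟨n, rfl⟩
    rcases Int.even_or_odd' n with ⟨m, rfl | rfl⟩
    · left
      rw [zpow_mul, h2, one_zpow, Perm.one_apply]
    · right
      rw [zpow_add, zpow_mul, h2, one_zpow, zpow_one, one_mul]
  · rintro (rfl | rfl)
    · exact Perm.SameCycle.refl _ _
    · exact ⟨1, rfl⟩

/-- The average over independent fair switches along the edges of `θ` in `Y`. -/
noncomputable def edgeAvg (θ : Perm X) (Y : Finset X) : Module.End ℝ (Perm X → ℝ) :=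
  subgroupAvg (edgeGroup θ Y)

theorem edgeAvg_nonneg (θ : Perm X) (Y : Finset X) {f : Perm X → ℝ} (hf : 0 ≤ f) :
    0 ≤ edgeAvg θ Y f :=
  subgroupAvg_nonneg _ hf

theorem edgeAvg_empty (θ : Perm X) : edgeAvg θ ∅ = 1 := by
  have : edgeGroup θ ∅ = ⊥ := by
    refine (Subgroup.eq_bot_iff_forall _).2 fun g hg => ?_
    ext x
    exact hg.2 x (by simp)
  rw [edgeAvg, this, subgroupAvg_bot]

theorem edgeAvg_mem_convexHull (θ : Perm X) (Y : Finset X) :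
    edgeAvg θ Y ∈ convexHull ℝ (translate '' (permsOn Y : Set (Perm X))) :=
  convexHull_mono (Set.image_mono (edgeGroup_le_permsOn θ Y)) (subgroupAvg_mem_convexHull _)

-- `Y` is a union of cycles of `θ`, so an element of the group for `Y ∪ Z` preserves `Y` and splits
-- into its restriction to `Y` and a remainder on `Z`.
open scoped Pointwise in
theorem edgeAvg_mul_edgeAvg {θ : Perm X} {Y Z : Finset X} (hY : ∀ x, θ x ∈ Y ↔ x ∈ Y)
    (hYZ : Disjoint Y Z) : edgeAvg θ Y * edgeAvg θ Z = edgeAvg θ (Y ∪ Z) := by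
  have hY' : ∀ {x y}, θ.SameCycle x y → (y ∈ Y ↔ x ∈ Y) := by
    rintro x _ ⟨n, rfl⟩
    have hθ : θ ∈ MulAction.stabilizer (Perm X) (Y : Set X) := by
      rw [MulAction.mem_stabilizer_set]
      exact hY
    have := (MulAction.stabilizer (Perm X) (Y : Set X)).zpow_mem hθ n
    rw [MulAction.mem_stabilizer_set] at this
    exact this x
  refine subgroupAvg_mul_of_commute ?_ ?_ ?_ ?_
  · exact fun g hg => ⟨hg.1, permsOn_mono Finset.subset_union_left hg.2⟩
  · exact fun g hg => ⟨hg.1, permsOn_mono Finset.subset_union_right hg.2⟩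
  · exact fun g hg h hh => commute_of_mem_permsOn hYZ hg.2 hh.2
  · intro g hg
    have hgY : ∀ x, g x ∈ Y ↔ x ∈ Y := fun x => hY' (hg.1 x)
    set h : Perm X := Perm.ofSubtype (g.subtypePerm hgY) with hh_def
    have h1 : ∀ x ∈ Y, h x = g x := fun x hx => by
      rw [hh_def, Perm.ofSubtype_apply_of_mem _ hx]; rfl
    have h2 : ∀ x ∉ Y, h x = x := fun x hx => by
      rw [hh_def, Perm.ofSubtype_apply_of_not_mem _ hx]
    have hh : h ∈ edgeGroup θ Y := by
      refine ⟨fun x => ?_, h2⟩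
      by_cases hx : x ∈ Y
      · rw [h1 x hx]; exact hg.1 x
      · rw [h2 x hx]
    refine ⟨h, hh, h⁻¹ * g, ⟨fun x => ?_, fun x hx => ?_⟩, by simp⟩
    · exact (hg.1 x).trans (((edgeGroup θ Y).inv_mem hh).1 (g x))
    · rw [Perm.mul_apply, Perm.inv_eq_iff_eq]
      by_cases hxY : x ∈ Y
      · exact (h1 x hxY).symm
      · rw [h2 x hxY]
        exact hg.2 x (by simp [hx, hxY])

theorem edgeAvg_pair {θ : Perm X} (hθ : Function.Involutive θ) (k : X) :
    edgeAvg θ {k, θ k} = lazyTranslate (swap k (θ k)) := by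
  have hs : swap k (θ k) ∈ edgeGroup θ {k, θ k} := by
    refine ⟨fun x => ?_, swap_mem_permsOn (by simp) (by simp)⟩
    rw [sameCycle_iff_of_involutive hθ]
    rcases eq_or_ne x k with rfl | hxk
    · simp
    rcases eq_or_ne x (θ k) with rfl | hxk'
    · simp [hθ k]
    · simp [swap_apply_of_ne_of_ne hxk hxk']
  have h1 : lazyTranslate (swap k (θ k)) * edgeAvg θ {k, θ k} = edgeAvg θ {k, θ k} := by
    rw [lazyTranslate, smul_mul_assoc, add_mul, one_mul, edgeAvg, translate_mul_subgroupAvg hs,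
      ← two_smul ℝ, smul_smul]
    norm_num
  have h2 : lazyTranslate (swap k (θ k)) * edgeAvg θ {k, θ k} = lazyTranslate (swap k (θ k)) := by
    refine mul_subgroupAvg_of_absorb fun h hh => ?_
    have hval := (sameCycle_iff_of_involutive hθ).1 (hh.1 k)
    have hval' := (sameCycle_iff_of_involutive hθ).1 (hh.1 (θ k))
    rw [hθ k] at hval'
    have key : h = 1 ∨ h = swap k (θ k) := by
      rcases hval with h0 | h0
      · left
        ext x
        rw [Perm.one_apply]
        rcases eq_or_ne x k with rfl | hxk
        · exact h0
        rcases eq_or_ne x (θ k) with rfl | hxk'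
        · rcases hval' with h' | h'
          · exact h'
          · exact absurd (h.injective (h'.trans h0.symm)) hxk
        · exact hh.2 x (by simp [hxk, hxk'])
      · right
        ext x
        rcases eq_or_ne x k with rfl | hxk
        · rw [swap_apply_left, h0]
        rcases eq_or_ne x (θ k) with rfl | hxk'
        · rw [swap_apply_right]
          rcases hval' with h' | h'
          · exact absurd (h.injective (h'.trans h0.symm)) hxk
          · exact h'
        · rw [swap_apply_of_ne_of_ne hxk hxk']
          exact hh.2 x (by simp [hxk, hxk'])
    rcases key with rfl | rfl
    · rw [map_one, mul_one]
    · rw [lazyTranslate, smul_mul_assoc, add_mul, one_mul, ← map_mul, swap_mul_self, map_one,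
        add_comm]
  rw [← h1, h2]

theorem translate_mul_edgeAvg (w θ : Perm X) (Y : Finset X) :
    translate w * edgeAvg θ Y = edgeAvg (w * θ * w⁻¹) (Y.map w.toEmbedding) * translate w := by
  refine translate_mul_subgroupAvg_conj w fun h => ?_
  simp only [mem_edgeGroup, Perm.sameCycle_conj, Perm.mul_apply]
  constructor
  · rintro ⟨h1, h2⟩
    refine ⟨fun x => by simpa using h1 (w x), fun x hx => ?_⟩
    rw [h2 (w x) (by simpa using hx)]
    simp
  · rintro ⟨h1, h2⟩
    refine ⟨fun x => by simpa using h1 (w⁻¹ x), fun x hx => ?_⟩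
    have := h2 (w⁻¹ x) (fun h' => hx (by
      rw [Finset.mem_map]
      exact ⟨_, h', by simp⟩))
    simpa using this

/-- The entropy lost by switching along random edges between `A` and `B`, if every point of `A` is
matched to a uniformly distributed point of `B`. -/
theorem sum_entropySum_edgeAvg_le {ι : Type*} {A B : Finset X} (hAB : Disjoint A B)
    (hB : B.Nonempty) {Ω : Finset ι} {θ : ι → Perm X} (hθ : ∀ ω, Function.Involutive (θ ω))
    (hbij : ∀ k ∈ A, Set.BijOn (fun ω => θ ω k) Ω B) (hΩ : Ω.card = B.card)
    {l : ℝ} (hl : Real.log (A ∪ B).card ≤ l) {f : Perm X → ℝ} (hf : 0 ≤ f)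
    {S : Finset X} (hS : S ⊆ A) :
    ∑ ω ∈ Ω, entropySum (edgeAvg (θ ω) (S ∪ S.image (θ ω)) f) ≤ Ω.card * (entropySum f -
      (64 * (4 + 3 * l))⁻¹ * (entropySum (forget B f) - entropySum (forget (S ∪ B) f))) := by
  have hBA : ∀ {ω}, ω ∈ Ω → ∀ {x}, x ∈ A → θ ω x ∈ B := fun hω x hx => (hbij x hx).mapsTo hω
  induction hn : S.card generalizing S with
  | zero =>
    obtain rfl := Finset.card_eq_zero.1 hn
    simp [edgeAvg_empty]
  | succ n ih =>
    have hSne : S.Nonempty := Finset.card_pos.1 (by omega)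
    have hSB : Disjoint S B := hAB.mono_left hS
    have hl' : Real.log (S ∪ B).card ≤ l := by
      refine le_trans (Real.log_le_log ?_ ?_) hl
      · exact_mod_cast Finset.card_pos.2 (hB.mono Finset.subset_union_right)
      · exact_mod_cast Finset.card_le_card (Finset.union_subset_union_left hS)
    have hlog : 0 ≤ Real.log (S ∪ B).card := Real.log_natCast_nonneg _
    -- The comparison of means holds only after summation over `S`, so the position to be peeled off
    -- is chosen by averaging.
    obtain ⟨k, hkS, hk⟩ : ∃ k ∈ S, triDiscSum (forget ((S ∪ B).erase k) f) (forget (S ∪ B) f) ≤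
        8 * triDiscSum (forget ((S ∪ B).erase k) f) ((B.card : ℝ)⁻¹ • ∑ b ∈ B,
        forget ((S ∪ B).erase k) (translate (swap k b) f)) := by
      refine Finset.exists_le_of_sum_le hSne ?_
      rw [← Finset.mul_sum]
      exact sum_triDiscSum_forget_le hSB hB hf
    have hkB : k ∉ B := Finset.disjoint_left.1 hSB hkS
    have hkT : k ∈ S ∪ B := Finset.mem_union_left _ hkS
    have herase : (S ∪ B).erase k = S.erase k ∪ B := by
      rw [Finset.erase_union_distrib, Finset.erase_eq_of_notMem hkB]
    set T' := (S ∪ B).erase k with hT'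
    -- The loss due to the edge at `k` is measured after forgetting `T'`. This set contains all
    -- other edges in use, so their switches are absorbed and `f` itself remains.
    have hstep : ∀ ω ∈ Ω, entropySum (edgeAvg (θ ω) (S ∪ S.image (θ ω)) f) +
        triDiscSum (forget T' f) (forget T' (translate (swap k (θ ω k)) f)) / 8 ≤
        entropySum (edgeAvg (θ ω) (S.erase k ∪ (S.erase k).image (θ ω)) f) := by
      intro ω hω
      set Y := S.erase k ∪ (S.erase k).image (θ ω) with hY
      have hYsub : Y ⊆ T' := by
        rw [herase, hY]
        refine Finset.union_subset_union_right ?_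
        intro x hx
        obtain ⟨y, hy, rfl⟩ := Finset.mem_image.1 hx
        exact hBA hω (hS (Finset.mem_of_mem_erase hy))
      have hkY : k ∉ Y := fun h => Finset.notMem_erase k _ (hYsub h)
      have hθY : ∀ x, θ ω x ∈ Y ↔ x ∈ Y := by
        have : ∀ x ∈ Y, θ ω x ∈ Y := by
          intro x hx
          rcases Finset.mem_union.1 hx with h | h
          · exact Finset.mem_union_right _ (Finset.mem_image_of_mem _ h)
          · obtain ⟨y, hy, rfl⟩ := Finset.mem_image.1 h
            rw [hθ ω y]
            exact Finset.mem_union_left _ hy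
        exact fun x => ⟨fun h => by simpa [hθ ω x] using this _ h, this x⟩
      have hdisj : Disjoint {k, θ ω k} Y := by
        rw [Finset.disjoint_insert_left, Finset.disjoint_singleton_left]
        exact ⟨hkY, fun h => hkY ((hθY k).1 h)⟩
      have hunion : S ∪ S.image (θ ω) = {k, θ ω k} ∪ Y := by
        conv_lhs => rw [← Finset.insert_erase hkS]
        rw [Finset.image_insert, hY]
        ext x
        simp only [Finset.mem_union, Finset.mem_insert, Finset.mem_singleton]
        tauto
      have hpair : ∀ x, θ ω x ∈ ({k, θ ω k} : Finset X) ↔ x ∈ ({k, θ ω k} : Finset X) := by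
        intro x
        simp only [Finset.mem_insert, Finset.mem_singleton, (θ ω).injective.eq_iff,
          (hθ ω).eq_iff]
        tauto
      have hmul : edgeAvg (θ ω) (S ∪ S.image (θ ω)) f =
          lazyTranslate (swap k (θ ω k)) (edgeAvg (θ ω) Y f) := by
        rw [hunion, ← edgeAvg_mul_edgeAvg hpair hdisj, edgeAvg_pair (hθ ω)]
        rfl
      have hψ : 0 ≤ edgeAvg (θ ω) Y f := edgeAvg_nonneg _ _ hf
      have h1 := triDiscSum_le_entropySum_sub (swap k (θ ω k)) hψ
      have h2 := triDiscSum_subgroupAvg_le (permsOn T') hψ (translate_nonneg (swap k (θ ω k)) hψ)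
      have habs : forget T' * edgeAvg (θ ω) Y = forget T' :=
        subgroupAvg_mul_subgroupAvg_of_le
          ((edgeGroup_le_permsOn _ _).trans (permsOn_mono hYsub))
      have hcomm : Commute (edgeAvg (θ ω) Y) (translate (swap k (θ ω k))) :=
        commute_subgroupAvg fun h hh => (commute_of_mem_permsOn hdisj.symm hh.2
          (swap_mem_permsOn (by simp) (by simp))).map translate
      have h3 : forget T' (edgeAvg (θ ω) Y f) = forget T' f := by
        rw [← Module.End.mul_apply, habs]
      have h4 : forget T' (translate (swap k (θ ω k)) (edgeAvg (θ ω) Y f)) =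
          forget T' (translate (swap k (θ ω k)) f) := by
        rw [← Module.End.mul_apply, ← Module.End.mul_apply, mul_assoc, ← hcomm.eq,
          ← mul_assoc, habs]
        rfl
      change triDiscSum (forget T' _) (forget T' _) ≤ _ at h2
      rw [h3, h4] at h2
      rw [hmul]
      linarith
    have hsum := Finset.sum_le_sum hstep
    rw [Finset.sum_add_distrib, ← Finset.sum_div] at hsum
    -- Only the marginal law of the partner of `k` enters here.
    have hreindex : ∑ ω ∈ Ω, triDiscSum (forget T' f) (forget T' (translate (swap k (θ ω k)) f)) =
        ∑ b ∈ B, triDiscSum (forget T' f) (forget T' (translate (swap k b) f)) := by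
      have := hbij k (hS hkS)
      exact Finset.sum_nbij (fun ω => θ ω k) this.mapsTo this.injOn this.surjOn fun _ _ => rfl
    have hmean := triDiscSum_mean_le hB (forget_nonneg T' hf)
      (v := fun b => forget T' (translate (swap k b) f))
      fun b => forget_nonneg T' (translate_nonneg _ hf)
    have hind := ih ((Finset.erase_subset _ _).trans hS) (by
      rw [Finset.card_erase_of_mem hkS, hn]; rfl)
    have hgain := entropySum_forget_erase_sub_le hkT hf
    rw [← hT'] at hgain
    rw [← herase] at hind
    set t := triDiscSum (forget T' f) (forget (S ∪ B) f)
    have ht : 0 ≤ t := triDiscSum_nonneg (forget_nonneg _ hf) (forget_nonneg _ hf)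
    have hc : 0 < 64 * (4 + 3 * l) := by nlinarith
    -- In 64 = 8 · 8 one factor comes from the loss in a fair switch, the other from the choice of
    -- `k`.
    have hgain' : (64 * (4 + 3 * l))⁻¹ * (entropySum (forget T' f) -
        entropySum (forget (S ∪ B) f)) ≤ t / 64 := by
      rw [inv_mul_le_iff₀ hc]
      nlinarith
    rw [hreindex] at hsum
    rw [hΩ] at hind ⊢
    have hB0 : (0 : ℝ) ≤ B.card := Nat.cast_nonneg _
    have h5 := mul_le_mul_of_nonneg_left hgain' hB0
    have h6 := mul_le_mul_of_nonneg_left hk hB0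
    linarith

end Edges

/-! ### The butterfly network on the cube -/

section Butterfly

open Equiv

variable {k : ℕ}

/-- Flip the bit with number `r`, where the bits are numbered from the right, starting with `0`. -/
def flipBit (k r : ℕ) : Perm (Cube k) :=
  Function.Involutive.toPerm (fun x j => if (j : ℕ) + r = k then !x j else x j) fun x => by
    ext j
    by_cases h : (j : ℕ) + r = k <;> simp [h]

theorem flipBit_apply (r : ℕ) (x : Cube k) (j : Fin (k + 1)) :
    flipBit k r x j = if (j : ℕ) + r = k then !x j else x j := rfl

theorem flipBit_involutive (k r : ℕ) : Function.Involutive (flipBit k r) :=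
  (flipBit k r).left_inv

/-- The positions whose bits with numbers `m, m + 1, …` vanish. -/
def low (k m : ℕ) : Finset (Cube k) :=
  Finset.univ.filter fun x => ∀ j : Fin (k + 1), (j : ℕ) + m ≤ k → x j = false

theorem mem_low {m : ℕ} {x : Cube k} :
    x ∈ low k m ↔ ∀ j : Fin (k + 1), (j : ℕ) + m ≤ k → x j = false := by
  simp [low]

/-- The positions whose highest nonzero bit is the one with number `m`. -/
def upper (k m : ℕ) : Finset (Cube k) := low k (m + 1) \ low k m

theorem low_subset_succ (m : ℕ) : low k m ⊆ low k (m + 1) := fun _ hx =>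
  mem_low.2 fun j hj => mem_low.1 hx j (by omega)

theorem disjoint_upper_low (m : ℕ) : Disjoint (upper k m) (low k m) := Finset.sdiff_disjoint

theorem upper_union_low (m : ℕ) : upper k m ∪ low k m = low k (m + 1) :=
  Finset.sdiff_union_of_subset (low_subset_succ m)

theorem low_nonempty (m : ℕ) : (low k m).Nonempty := ⟨fun _ => false, mem_low.2 fun _ _ => rfl⟩

theorem low_zero : low k 0 = {fun _ => false} := by
  ext x
  rw [mem_low, Finset.mem_singleton]
  constructor
  · exact fun h => funext fun j => h j (by omega)
  · rintro rfl j -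
    rfl

theorem low_succ_self : low k (k + 1) = Finset.univ := by
  ext x
  simp only [mem_low, Finset.mem_univ, iff_true]
  intro j hj
  omega

theorem mem_upper {m : ℕ} (hm : m ≤ k) {x : Cube k} :
    x ∈ upper k m ↔ x ∈ low k (m + 1) ∧ x ⟨k - m, by omega⟩ = true := by
  rw [upper, Finset.mem_sdiff]
  refine and_congr_right fun hx => ?_
  constructor
  · intro h
    by_contra h'
    refine h (mem_low.2 fun j hj => ?_)
    rcases hj.lt_or_eq with hj | hj
    · exact mem_low.1 hx j (by omega)
    · have : j = ⟨k - m, by omega⟩ := Fin.ext (by simp; omega)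
      rw [this]
      simpa using h'
  · intro h h'
    have := mem_low.1 h' ⟨k - m, by omega⟩ (by simp; omega)
    simp [this] at h

theorem flipBit_mem_upper {m : ℕ} (hm : m ≤ k) {x : Cube k} (hx : x ∈ low k m) :
    flipBit k m x ∈ upper k m := by
  rw [mem_upper hm, mem_low]
  refine ⟨fun j hj => ?_, ?_⟩
  · rw [flipBit_apply, if_neg (by omega)]
    exact mem_low.1 hx j (by omega)
  · rw [flipBit_apply, if_pos (by simp; omega), mem_low.1 hx _ (by simp; omega)]
    rfl

theorem flipBit_mem_low {m : ℕ} (hm : m ≤ k) {x : Cube k} (hx : x ∈ upper k m) :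
    flipBit k m x ∈ low k m := by
  rw [mem_upper hm, mem_low] at hx
  refine mem_low.2 fun j hj => ?_
  rw [flipBit_apply]
  split_ifs with h
  · have : j = ⟨k - m, by omega⟩ := Fin.ext (by simp; omega)
    rw [this, hx.2]
    rfl
  · exact hx.1 j (by omega)

theorem flipBit_mem_low_iff {r m : ℕ} (hr : r < m) (x : Cube k) :
    flipBit k r x ∈ low k m ↔ x ∈ low k m := by
  rw [mem_low, mem_low]
  refine forall_congr' fun j => imp_congr_right fun hj => ?_
  rw [flipBit_apply, if_neg (by omega)]

theorem flipBit_mem_upper_iff {r m : ℕ} (hr : r < m) (x : Cube k) :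
    flipBit k r x ∈ upper k m ↔ x ∈ upper k m := by
  rw [upper, Finset.mem_sdiff, Finset.mem_sdiff, flipBit_mem_low_iff hr,
    flipBit_mem_low_iff (hr.trans (Nat.lt_succ_self m))]

theorem card_low_le {m : ℕ} (hm : m ≤ k + 1) : (low k m).card ≤ 2 ^ m := by
  induction m with
  | zero => simp [low_zero]
  | succ m ih =>
    have h1 : (upper k m).card ≤ (low k m).card :=
      Finset.card_le_card_of_injOn (flipBit k m) (fun x hx => flipBit_mem_low (by omega) hx)
        (flipBit k m).injective.injOn
    have h2 := Finset.card_union_le (upper k m) (low k m)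
    rw [upper_union_low] at h2
    have := ih (by omega)
    rw [pow_succ]
    omega

/-- The average over independent switches in the directions `0, …, n - 1` (in this order) along the
edges in `Y`. -/
noncomputable def butterfly (Y : Finset (Cube k)) : ℕ → Module.End ℝ (Perm (Cube k) → ℝ)
  | 0 => 1
  | n + 1 => edgeAvg (flipBit k n) Y * butterfly Y n

theorem butterfly_mem_convexHull (Y : Finset (Cube k)) (n : ℕ) :
    butterfly Y n ∈ convexHull ℝ (translate '' (permsOn Y : Set (Perm (Cube k)))) := by
  induction n with
  | zero => exact subset_convexHull ℝ _ ⟨1, (permsOn Y).one_mem, map_one _⟩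
  | succ n ih => exact mul_mem_convexHull_translate (edgeAvg_mem_convexHull _ _) ih

/-- Directions below `m` preserve both halves, and moves of disjoint sets commute. -/
theorem butterfly_low_succ {m n : ℕ} (hn : n ≤ m) :
    butterfly (low k (m + 1)) n = butterfly (upper k m) n * butterfly (low k m) n := by
  induction n with
  | zero => simp [butterfly]
  | succ n ih =>
    have hcomm : Commute (edgeAvg (flipBit k n) (low k m)) (butterfly (upper k m) n) := by
      refine commute_of_mem_convexHull_translate (fun h hh => ?_) (butterfly_mem_convexHull _ _)
      exact commute_subgroupAvg fun g hg => (commute_of_mem_permsOn (disjoint_upper_low m).symm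
        hg.2 hh).map translate
    rw [butterfly, butterfly, butterfly, ih (by omega), ← upper_union_low,
      ← edgeAvg_mul_edgeAvg (flipBit_mem_upper_iff (by omega)) (disjoint_upper_low m)]
    rw [mul_assoc, ← mul_assoc (edgeAvg _ (low k m)), hcomm.eq]
    simp only [mul_assoc]

/-- Add the bits of `v` with numbers less than `m` to the positions in `upper k m`. -/
def maskXor (k m : ℕ) (v : Cube k) (x : Cube k) : Cube k := fun j =>
  if x ∈ upper k m ∧ k < j + m then xor (x j) (v j) else x j

theorem maskXor_mem_low {m : ℕ} (v x : Cube k) : maskXor k m v x ∈ low k m ↔ x ∈ low k m := by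
  rw [mem_low, mem_low]
  refine forall_congr' fun j => imp_congr_right fun hj => ?_
  rw [maskXor, if_neg (by omega)]

theorem maskXor_mem_upper {m : ℕ} (v x : Cube k) :
    maskXor k m v x ∈ upper k m ↔ x ∈ upper k m := by
  rw [upper, Finset.mem_sdiff, Finset.mem_sdiff, maskXor_mem_low]
  refine and_congr_left fun _ => ?_
  rw [mem_low, mem_low]
  refine forall_congr' fun j => imp_congr_right fun hj => ?_
  rw [maskXor, if_neg (by omega)]

theorem maskXor_maskXor {m : ℕ} (u v x : Cube k) (j : Fin (k + 1)) :
    maskXor k m u (maskXor k m v x) j =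
      if x ∈ upper k m ∧ k < j + m then xor (xor (x j) (v j)) (u j) else x j := by
  by_cases h : x ∈ upper k m ∧ k < j + m
  · rw [maskXor, if_pos ⟨(maskXor_mem_upper v x).2 h.1, h.2⟩, maskXor, if_pos h, if_pos h]
  · rw [maskXor, if_neg fun h' => h ⟨(maskXor_mem_upper v x).1 h'.1, h'.2⟩, maskXor, if_neg h,
      if_neg h]

theorem maskXor_involutive (m : ℕ) (v : Cube k) : Function.Involutive (maskXor k m v) := by
  intro x
  ext j
  rw [maskXor_maskXor]
  split_ifs <;> simp

/-- `maskXor` as a permutation. -/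
def maskPerm (k m : ℕ) (v : Cube k) : Perm (Cube k) := (maskXor_involutive m v).toPerm

theorem maskPerm_apply (m : ℕ) (v x : Cube k) : maskPerm k m v x = maskXor k m v x := rfl

theorem maskPerm_mem_permsOn (m : ℕ) (v : Cube k) : maskPerm k m v ∈ permsOn (upper k m) := by
  intro x hx
  ext j
  rw [maskPerm_apply, maskXor, if_neg fun h => hx h.1]

theorem maskPerm_flipBit_mem_edgeGroup {m n : ℕ} (hn : n < m) :
    maskPerm k m (flipBit k n fun _ => false) ∈ edgeGroup (flipBit k n) (upper k m) := by
  refine ⟨fun x => ?_, maskPerm_mem_permsOn _ _⟩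
  rw [sameCycle_iff_of_involutive (flipBit_involutive k n)]
  by_cases hx : x ∈ upper k m
  · right
    ext j
    rw [maskPerm_apply, maskXor, flipBit_apply, flipBit_apply]
    split_ifs with h1 h2 h3
    · simp
    · simp
    · exact absurd ⟨hx, by omega⟩ h1
    · rfl
  · left
    exact maskPerm_mem_permsOn _ _ x hx

theorem commute_maskPerm_flipBit {m n : ℕ} (hn : n < m) (v : Cube k) :
    Commute (maskPerm k m v) (flipBit k n) := by
  refine Equiv.ext fun x => funext fun j => ?_
  simp only [Perm.mul_apply, maskPerm_apply, maskXor, flipBit_apply, flipBit_mem_upper_iff hn]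
  split_ifs <;> simp

theorem commute_translate_maskPerm_butterfly {m n : ℕ} (hn : n ≤ m) (v : Cube k) :
    Commute (translate (maskPerm k m v)) (butterfly (upper k m) n) := by
  induction n with
  | zero => exact Commute.one_right _
  | succ n ih =>
    refine Commute.mul_right ?_ (ih (by omega))
    have h1 := translate_mul_edgeAvg (maskPerm k m v) (flipBit k n) (upper k m)
    have h2 : (upper k m).map (maskPerm k m v).toEmbedding = upper k m := by
      refine Finset.eq_of_subset_of_card_le (fun x hx => ?_) (by simp)
      obtain ⟨y, hy, rfl⟩ := Finset.mem_map.1 hx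
      exact (maskXor_mem_upper v y).2 hy
    rw [h2, (commute_maskPerm_flipBit (by omega) v).eq, mul_inv_cancel_right] at h1
    exact h1

/-- The one-bit mask commutes past the directions applied before `n` and is absorbed by the fair
switches in direction `n`. -/
theorem butterfly_mul_maskPerm_flipBit {m n N : ℕ} (hn : n < N) (hN : N ≤ m) :
    butterfly (upper k m) N * translate (maskPerm k m (flipBit k n fun _ => false)) =
      butterfly (upper k m) N := by
  induction N with
  | zero => omega
  | succ N ih =>
    rw [butterfly, mul_assoc]
    rcases (Nat.lt_succ_iff.1 hn).lt_or_eq with h | rfl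
    · rw [ih h (by omega)]
    · rw [← (commute_translate_maskPerm_butterfly (by omega) _).eq, ← mul_assoc, edgeAvg,
        subgroupAvg_mul_translate (maskPerm_flipBit_mem_edgeGroup (by omega))]

theorem butterfly_mul_maskPerm {m n : ℕ} (hn : n ≤ m) (hm : m ≤ k) {v : Cube k}
    (hv : v ∈ low k n) :
    butterfly (upper k m) m * translate (maskPerm k m v) = butterfly (upper k m) m := by
  induction n generalizing v with
  | zero =>
    rw [low_zero, Finset.mem_singleton] at hv
    have : maskPerm k m v = 1 := by
      refine Equiv.ext fun x => funext fun j => ?_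
      rw [maskPerm_apply, maskXor, hv]
      simp
    rw [this, map_one, mul_one]
  | succ n ih =>
    by_cases hv' : v ∈ low k n
    · exact ih (by omega) hv'
    · have h1 : flipBit k n v ∈ low k n :=
        flipBit_mem_low (by omega) (Finset.mem_sdiff.2 ⟨hv, hv'⟩)
      have h2 : maskPerm k m v =
          maskPerm k m (flipBit k n v) * maskPerm k m (flipBit k n fun _ => false) := by
        refine Equiv.ext fun x => funext fun j => ?_
        simp only [Perm.mul_apply, maskPerm_apply]
        rw [maskXor_maskXor, maskXor, flipBit_apply, flipBit_apply]
        split_ifs <;> simp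
      rw [h2, map_mul, ← mul_assoc, ih (by omega) h1,
        butterfly_mul_maskPerm_flipBit (by omega) le_rfl]

theorem injOn_maskXor {m : ℕ} {x : Cube k} (hx : x ∈ upper k m) :
    Set.InjOn (fun v => maskXor k m v x) (low k m) := by
  intro v hv v' hv' h
  ext j
  by_cases hj : k < j + m
  · have := congrFun h j
    simpa [maskXor, hx, hj] using this
  · rw [mem_low.1 hv j (by omega), mem_low.1 hv' j (by omega)]

theorem entropySum_butterfly_succ_le {m : ℕ} (hm : m ≤ k) {f : Perm (Cube k) → ℝ} (hf : 0 ≤ f) :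
    entropySum (butterfly (low k (m + 1)) (m + 1) f) ≤ entropySum (butterfly (low k m) m f) -
      (64 * (4 + 3 * ((k : ℝ) + 1)))⁻¹ *
        (entropySum (forget (low k m) f) - entropySum (forget (low k (m + 1)) f)) := by
  set ψ := butterfly (low k m) m f with hψ_def
  have hψ : 0 ≤ ψ := nonneg_of_mem_convexHull_translate (butterfly_mem_convexHull _ _) hf
  -- The earlier switches stay inside `low k m` and are forgotten. The increments therefore belong
  -- to `f` rather than to `ψ`, which lets them telescope in `m`.
  have hforget : ∀ S, low k m ⊆ S → forget S ψ = forget S f := by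
    intro S hS
    rw [hψ_def, ← Module.End.mul_apply]
    congr 1
    exact mul_eq_of_mem_convexHull_translate
      (fun h hh => subgroupAvg_mul_translate (permsOn_mono hS hh)) (butterfly_mem_convexHull _ _)
  rw [← hforget _ (subset_refl _), ← hforget _ (low_subset_succ m)]
  have hcard : ((low k m).card : ℝ) ≠ 0 := by exact_mod_cast (low_nonempty m).card_pos.ne'
  -- The random mask is inserted at no cost, by `hQ`.
  set χ := ((low k m).card : ℝ)⁻¹ • ∑ v ∈ low k m, translate (maskPerm k m v) ψ with hχ_def
  have hχ : 0 ≤ χ := fun x => by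
    simp only [hχ_def, Pi.smul_apply, Finset.sum_apply]
    exact smul_nonneg (by positivity) (Finset.sum_nonneg fun v _ => translate_nonneg _ hψ x)
  have hQ : butterfly (upper k m) m χ = butterfly (upper k m) m ψ := by
    rw [hχ_def, map_smul, map_sum]
    have : ∀ v ∈ low k m, butterfly (upper k m) m (translate (maskPerm k m v) ψ) =
        butterfly (upper k m) m ψ := fun v hv => by
      rw [← Module.End.mul_apply, butterfly_mul_maskPerm le_rfl hm hv]
    rw [Finset.sum_congr rfl this, Finset.sum_const, ← Nat.cast_smul_eq_nsmul ℝ, smul_smul,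
      inv_mul_cancel₀ hcard, one_smul]
  have hfac : butterfly (low k (m + 1)) (m + 1) f =
      edgeAvg (flipBit k m) (low k (m + 1)) (butterfly (upper k m) m χ) := by
    rw [hQ, butterfly, butterfly_low_succ le_rfl]
    rfl
  rw [hfac]
  -- The upper butterfly is frozen to one permutation `g`. The remaining randomness of the matching
  -- is the mask.
  refine entropySum_le_of_mem_convexHull (fun _ h => edgeAvg_nonneg _ _ h) hχ ?_
    (butterfly_mem_convexHull (upper k m) m)
  intro g hg
  set w : Cube k → Perm (Cube k) := fun v => g * maskPerm k m v with hw_def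
  have hw : ∀ v, w v ∈ permsOn (upper k m) := fun v =>
    (permsOn _).mul_mem hg (maskPerm_mem_permsOn m v)
  -- Conjugation turns "move by `g` and the mask, then switch in direction `m`" into switching along
  -- the matching `θ v`, up to a translation that keeps the entropy.
  set θ : Cube k → Perm (Cube k) := fun v => (w v)⁻¹ * flipBit k m * w v with hθ_def
  have hθ : ∀ v, Function.Involutive (θ v) := fun v x => by
    simp [hθ_def, flipBit_involutive k m ((w v) x)]
  have hlow : ∀ v, ∀ x ∈ low k m, (w v)⁻¹ x = x := fun v x hx =>
    (permsOn _).inv_mem (hw v) x (Finset.disjoint_right.1 (disjoint_upper_low m) hx)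
  have hθA : ∀ v, ∀ x ∈ upper k m, θ v x = flipBit k m (w v x) := fun v x hx =>
    hlow v _ (flipBit_mem_low hm ((apply_mem_of_mem_permsOn (hw v)).2 hx))
  have hθmem : ∀ v, ∀ x ∈ upper k m, θ v x ∈ low k m := fun v x hx => by
    rw [hθA v x hx]
    exact flipBit_mem_low hm ((apply_mem_of_mem_permsOn (hw v)).2 hx)
  have hbij : ∀ x ∈ upper k m, Set.BijOn (fun v => θ v x) (low k m) (low k m) := by
    intro x hx
    have hinj : Set.InjOn (fun v => θ v x) (low k m) := by
      intro v hv v' hv' h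
      simp only [hθA _ x hx, (flipBit k m).injective.eq_iff, hw_def, Perm.mul_apply,
        g.injective.eq_iff, maskPerm_apply] at h
      exact injOn_maskXor hx hv hv' h
    have hmaps : Set.MapsTo (fun v => θ v x) (low k m) (low k m) := fun v _ => hθmem v x hx
    exact ⟨hmaps, hinj, Finset.surjOn_of_injOn_of_card_le _ hmaps hinj le_rfl⟩
  have himage : ∀ v, upper k m ∪ (upper k m).image (θ v) = low k (m + 1) := by
    intro v
    rw [← upper_union_low]
    congr 1
    ext y
    rw [Finset.mem_image]
    constructor
    · rintro ⟨x, hx, rfl⟩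
      exact hθmem v x hx
    · intro hy
      refine ⟨θ v y, ?_, hθ v y⟩
      have hwy : w v y = y :=
        hw v y (Finset.disjoint_right.1 (disjoint_upper_low m) hy)
      change (w v)⁻¹ (flipBit k m (w v y)) ∈ _
      rw [hwy, apply_mem_of_mem_permsOn ((permsOn _).inv_mem (hw v))]
      exact flipBit_mem_upper hm hy
  have hconj : ∀ v, entropySum (edgeAvg (flipBit k m) (low k (m + 1)) (translate (w v) ψ)) =
      entropySum (edgeAvg (θ v) (upper k m ∪ (upper k m).image (θ v)) ψ) := by
    intro v
    rw [himage, ← entropySum_translate (w v)⁻¹]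
    have h1 := translate_mul_edgeAvg (w v)⁻¹ (flipBit k m) (low k (m + 1))
    have h2 : (low k (m + 1)).map ((w v)⁻¹).toEmbedding = low k (m + 1) := by
      refine Finset.eq_of_subset_of_card_le (fun x hx => ?_) (by simp)
      obtain ⟨y, hy, rfl⟩ := Finset.mem_map.1 hx
      exact (apply_mem_of_mem_permsOn (permsOn_mono Finset.sdiff_subset
        ((permsOn _).inv_mem (hw v)))).2 hy
    rw [h2, inv_inv] at h1
    rw [← Module.End.mul_apply, h1, Module.End.mul_apply, ← Module.End.mul_apply (translate _),
      ← map_mul, inv_mul_cancel, map_one]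
    rfl
  have hl : Real.log (upper k m ∪ low k m).card ≤ (k : ℝ) + 1 := by
    rw [upper_union_low]
    have h1 : ((low k (m + 1)).card : ℝ) ≤ 2 ^ (m + 1) := by
      exact_mod_cast card_low_le (by omega)
    have h2 : (0 : ℝ) < (low k (m + 1)).card := by
      exact_mod_cast (low_nonempty (m + 1)).card_pos
    calc Real.log (low k (m + 1)).card ≤ Real.log (2 ^ (m + 1)) := Real.log_le_log h2 h1
      _ = (m + 1 : ℕ) * Real.log 2 := Real.log_pow _ _
      _ ≤ (m + 1 : ℕ) * 1 := by
          have := Real.log_two_lt_d9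
          gcongr
          linarith
      _ ≤ (k : ℝ) + 1 := by
          rw [mul_one]; exact_mod_cast Nat.succ_le_succ hm
  have hmain := sum_entropySum_edgeAvg_le (disjoint_upper_low m) (low_nonempty m) hθ hbij rfl hl hψ
    (subset_refl _)
  rw [← Finset.sum_congr rfl fun v _ => hconj v, upper_union_low] at hmain
  have hjensen := entropySum_mean_le (low_nonempty (k := k) m)
    (v := fun v => edgeAvg (flipBit k m) (low k (m + 1)) (translate (w v) ψ))
    fun v => edgeAvg_nonneg _ _ (translate_nonneg _ hψ)
  have heq : edgeAvg (flipBit k m) (low k (m + 1)) (translate g χ) = ((low k m).card : ℝ)⁻¹ •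
      ∑ v ∈ low k m, edgeAvg (flipBit k m) (low k (m + 1)) (translate (w v) ψ) := by
    simp [hχ_def, hw_def, map_mul]
  rw [heq]
  refine hjensen.trans ?_
  rw [inv_mul_le_iff₀ (by positivity)]
  exact hmain

theorem forget_low_zero : forget (low k 0) = 1 := by
  have : permsOn (low k 0) = ⊥ := by
    refine (Subgroup.eq_bot_iff_forall _).2 fun g hg => ?_
    have h1 : ∀ x, x ≠ (fun _ => false) → g x = x := fun x hx => hg x (by simpa [low_zero] using hx)
    refine Equiv.ext fun x => ?_
    by_cases hx : x = fun _ => false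
    · by_contra hne
      have h2 := h1 (g x) (fun h => hne (by rw [h, hx]; rfl))
      exact hne (g.injective h2)
    · exact h1 x hx
  rw [forget, this, subgroupAvg_bot]

/-- A round of switches in all directions diminishes the relative entropy by a factor
`1 - c / (k + 1)`. -/
theorem entropySum_butterfly_le {f : Perm (Cube k) → ℝ} (hf : 0 ≤ f) :
    entropySum (butterfly Finset.univ (k + 1) f) ≤ entropySum f -
      (64 * (4 + 3 * ((k : ℝ) + 1)))⁻¹ * (entropySum f - entropySum (forget Finset.univ f)) := by
  -- The increments telescope from `low k 0`, a single position where nothing is forgotten, to the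
  -- whole cube.
  have key : ∀ m ≤ k + 1, entropySum (butterfly (low k m) m f) ≤ entropySum f -
      (64 * (4 + 3 * ((k : ℝ) + 1)))⁻¹ * (entropySum f - entropySum (forget (low k m) f)) := by
    intro m hm
    induction m with
    | zero => simp [forget_low_zero, butterfly]
    | succ m ih =>
      have h1 := ih (by omega)
      have h2 := entropySum_butterfly_succ_le (show m ≤ k by omega) hf
      linarith
  have := key (k + 1) le_rfl
  rwa [low_succ_self] at this

end Butterfly

open Equiv

/-! ### Shuffles as operators, time reversal and Pinsker's inequality -/

section Shuffle

variable {Ω α : Type*} [Fintype Ω] [Fintype α] [DecidableEq α]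

/-- The evolution of the law of an arrangement in one step of a shuffle. -/
noncomputable def shuffleOp (ν : Ω → Perm α) : Module.End ℝ (Perm α → ℝ) :=
  (Fintype.card Ω : ℝ)⁻¹ • ∑ ω, translate (ν ω)

theorem shuffleMatrix_pow_apply (ν : Ω → Perm α) (t : ℕ) (π : Perm α) :
    (shuffleMatrix ν ^ t) π = (shuffleOp ν ^ t) (Pi.single π 1) := by
  induction t with
  | zero =>
    funext σ
    simp [Matrix.one_apply, Pi.single_apply, eq_comm]
  | succ t ih =>
    funext σ
    rw [pow_succ, pow_succ', Module.End.mul_apply, ← ih, Matrix.mul_apply]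
    simp only [shuffleMatrix, Matrix.of_apply, shuffleOp, LinearMap.smul_apply,
      LinearMap.sum_apply, Pi.smul_apply, Finset.sum_apply, translate_apply, smul_eq_mul]
    set μ := (Matrix.of (fun π σ => ((Finset.univ.filter fun ω : Ω => ν ω * π = σ).card : ℝ) /
      (Fintype.card Ω : ℝ)) ^ t : Matrix (Perm α) (Perm α) ℝ) π
    have h : ∀ τ : Perm α, ((Finset.univ.filter fun ω : Ω => ν ω * τ = σ).card : ℝ) =
        ∑ ω, if τ = (ν ω)⁻¹ * σ then 1 else 0 := by
      intro τ
      rw [Finset.card_filter]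
      push_cast
      exact Finset.sum_congr rfl fun ω _ => if_congr (by rw [eq_inv_mul_iff_mul_eq]) rfl rfl
    simp_rw [h, mul_div_assoc', Finset.mul_sum, ← Finset.sum_div]
    rw [Finset.sum_comm, div_eq_inv_mul, Finset.mul_sum]
    simp

theorem shuffleMatrix_pow_mul_right (ν : Ω → Perm α) (t : ℕ) (π σ h : Perm α) :
    (shuffleMatrix ν ^ t) (π * h) (σ * h) = (shuffleMatrix ν ^ t) π σ := by
  have h1 : Matrix.reindexAlgEquiv ℝ ℝ (Equiv.mulRight h) (shuffleMatrix ν) =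
      shuffleMatrix ν := by
    ext π σ
    simp [shuffleMatrix, ← mul_assoc]
  have h2 := congrFun (congrFun (map_pow (Matrix.reindexAlgEquiv ℝ ℝ (Equiv.mulRight h))
    (shuffleMatrix ν) t) (π * h)) (σ * h)
  rw [h1] at h2
  rw [← h2]
  simp

/-- Invariance under right multiplication gives p^t(σ, π) = p^t(π, πσ⁻¹π), so a column is a
rearrangement of a row. -/
theorem distUniform_shuffleMatrix_col (ν : Ω → Perm α) (t : ℕ) (π : Perm α) :
    distUniform (fun σ => (shuffleMatrix ν ^ t) σ π) = distUniform ((shuffleMatrix ν ^ t) π) := by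
  refine Fintype.sum_equiv
    (((Equiv.inv (Perm α)).trans (Equiv.mulLeft π)).trans (Equiv.mulRight π)) _ _ fun σ => ?_
  have := shuffleMatrix_pow_mul_right ν t σ π (σ⁻¹ * π)
  rw [mul_inv_cancel_left] at this
  change |(shuffleMatrix ν ^ t) σ π - _| = |(shuffleMatrix ν ^ t) π (π * σ⁻¹ * π) - _|
  rw [← this, mul_assoc]

theorem shuffleMatrix_eq_reindex_transpose {Ω' β : Type*} [Fintype Ω'] [Fintype β]
    [DecidableEq β] {ν : Ω → Perm α} {ν' : Ω' → Perm β} (η : Ω' ≃ Ω) (e : α ≃ β)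
    (h : ∀ ω, ν' ω = e.permCongr (ν (η ω))⁻¹) :
    shuffleMatrix ν' =
      Matrix.reindexAlgEquiv ℝ ℝ e.permCongr (shuffleMatrix ν).transpose := by
  ext π σ
  obtain ⟨π, rfl⟩ := e.permCongr.surjective π
  obtain ⟨σ, rfl⟩ := e.permCongr.surjective σ
  have hmul : ∀ a b, e.permCongr a * e.permCongr b = e.permCongr (a * b) := fun a b =>
    (map_mul e.permCongrHom a b).symm
  simp only [shuffleMatrix, Matrix.of_apply, Matrix.coe_reindexAlgEquiv, Matrix.reindex_apply,
    Matrix.submatrix_apply, Matrix.transpose_apply]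
  rw [Fintype.card_congr η]
  congr 2
  refine Finset.card_equiv η fun ω => ?_
  simp only [Finset.mem_filter, Finset.mem_univ, true_and]
  rw [h, hmul, e.permCongr.injective.eq_iff, Equiv.symm_apply_apply, Equiv.symm_apply_apply,
    inv_mul_eq_iff_eq_mul, eq_comm]

theorem distUniform_shuffleMatrix_inv {Ω' β : Type*} [Fintype Ω'] [Fintype β]
    [DecidableEq β] {ν : Ω → Perm α} {ν' : Ω' → Perm β} (η : Ω' ≃ Ω) (e : α ≃ β)
    (h : ∀ ω, ν' ω = e.permCongr (ν (η ω))⁻¹) (t : ℕ) (π : Perm β) :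
    distUniform ((shuffleMatrix ν' ^ t) π) =
      distUniform ((shuffleMatrix ν ^ t) (e.permCongr.symm π)) := by
  rw [shuffleMatrix_eq_reindex_transpose η e h, ← map_pow,
    ← distUniform_shuffleMatrix_col]
  unfold distUniform
  rw [Fintype.card_congr e.permCongr]
  refine (Fintype.sum_equiv e.permCongr _ _ fun σ => ?_).symm
  change _ = |((shuffleMatrix ν).transpose ^ t) (e.permCongr.symm π)
    (e.permCongr.symm (e.permCongr σ)) - _|
  rw [Equiv.symm_apply_apply, ← Matrix.transpose_pow]
  rfl

theorem shuffleOp_mem_convexHull [Nonempty Ω] (ν : Ω → Perm α) :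
    shuffleOp ν ∈ convexHull ℝ (translate '' (permsOn (Finset.univ : Finset α) : Set (Perm α))) := by
  rw [shuffleOp, Finset.smul_sum]
  refine (convex_convexHull ℝ _).sum_mem (fun _ _ => by positivity) ?_ fun ω _ =>
    subset_convexHull ℝ _ ⟨ν ω, fun x hx => absurd (Finset.mem_univ x) hx, rfl⟩
  rw [Finset.sum_const, nsmul_eq_mul, Finset.card_univ, mul_inv_cancel₀]
  exact_mod_cast Fintype.card_ne_zero

theorem forget_univ_apply (f : Perm α → ℝ) (x : Perm α) :
    forget Finset.univ f x = (∑ y, f y) / Fintype.card (Perm α) := by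
  have hmem : ∀ g : Perm α, g ∈ permsOn Finset.univ := fun g x hx =>
    absurd (Finset.mem_univ x) hx
  have hconst : ∀ y, forget Finset.univ f y = forget Finset.univ f x := by
    intro y
    have h := congrFun (congrArg (fun Q : Module.End ℝ (Perm α → ℝ) => Q f)
      (translate_mul_subgroupAvg (hmem (y * x⁻¹)))) y
    have h' : forget Finset.univ f ((y * x⁻¹)⁻¹ * y) = forget Finset.univ f y := h
    rw [← h']
    group
  have hsum := sum_subgroupAvg_mul (H := permsOn Finset.univ) f (fun _ => 1) fun _ _ => rfl
  simp only [mul_one] at hsum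
  rw [← hsum, eq_div_iff (by exact_mod_cast Fintype.card_ne_zero)]
  change _ = ∑ y, forget Finset.univ f y
  rw [Finset.sum_congr rfl fun y _ => hconst y, Finset.sum_const, nsmul_eq_mul, Finset.card_univ,
    mul_comm]

/-- The entropy of `f` relative to the uniform distribution. -/
noncomputable def relEntropy (f : Perm α → ℝ) : ℝ :=
  entropySum f - entropySum (forget Finset.univ f)

/-- A form of Pinsker's inequality. -/
theorem sq_distUniform_le {f : Perm α → ℝ} (hf : 0 ≤ f) (hsum : ∑ x, f x = 1) :
    distUniform f ^ 2 ≤ 4 * relEntropy f := by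
  have hc : (0 : ℝ) < Fintype.card (Perm α) := by exact_mod_cast Fintype.card_pos
  set u : ℝ := 1 / Fintype.card (Perm α) with hu_def
  have hu : 0 < u := by positivity
  have hcu : (Fintype.card (Perm α) : ℝ) * u = 1 := by rw [hu_def]; field_simp
  have hent : relEntropy f = ∑ x, (f x * Real.log (f x) - f x * Real.log u - f x + u) := by
    have h1 : ∀ x, forget Finset.univ f x = u := fun x => by rw [forget_univ_apply, hsum]
    simp only [relEntropy, entropySum, h1, Finset.sum_add_distrib, Finset.sum_sub_distrib,
      ← Finset.sum_mul, hsum, Finset.sum_const, nsmul_eq_mul, Finset.card_univ]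
    rw [hcu]
    ring
  have h1 : ∑ x, triDisc (f x) u ≤ 2 * relEntropy f := by
    rw [hent, Finset.mul_sum]
    refine Finset.sum_le_sum fun x _ => ?_
    have := triDisc_le_sq_sqrt_sub_sqrt (hf x) hu.le
    have := sq_sqrt_sub_sqrt_le_mul_log (hf x) hu
    linarith
  -- Cauchy–Schwarz with the weights f + u, whose total mass is 2.
  have h2 : distUniform f ^ 2 ≤ (∑ x, triDisc (f x) u) * ∑ x, (f x + u) := by
    refine Finset.sum_sq_le_sum_mul_sum_of_sq_le_mul _ (fun x _ => triDisc_nonneg (hf x) hu.le)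
      (fun x _ => add_nonneg (hf x) hu.le) fun x _ => ?_
    have : f x + u ≠ 0 := (add_pos_of_nonneg_of_pos (hf x) hu).ne'
    exact (by rw [sq_abs, triDisc, div_mul_cancel₀ _ this] : _ = _).le
  have h3 : ∑ x, (f x + u) = 2 := by
    rw [Finset.sum_add_distrib, hsum, Finset.sum_const, nsmul_eq_mul, Finset.card_univ, hcu]
    norm_num
  rw [h3] at h2
  linarith

theorem relEntropy_single (π : Perm α) :
    relEntropy (Pi.single π 1) = Real.log (Fintype.card α).factorial := by
  have h1 : entropySum (Pi.single π (1 : ℝ)) = 0 := by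
    refine Finset.sum_eq_zero fun x _ => ?_
    rcases eq_or_ne x π with rfl | h
    · simp
    · simp [h]
  have h2 : ∀ x, forget Finset.univ (Pi.single π (1 : ℝ)) x =
      ((Fintype.card α).factorial : ℝ)⁻¹ := fun x => by
    rw [forget_univ_apply, Fintype.card_perm, Finset.sum_pi_single']
    simp
  have hc : ((Fintype.card α).factorial : ℝ) ≠ 0 := by positivity
  rw [relEntropy, h1, entropySum]
  simp only [h2, Finset.sum_const, nsmul_eq_mul, Finset.card_univ, Fintype.card_perm]
  rw [mul_inv_cancel_left₀ hc, Real.log_inv]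
  ring

end Shuffle

/-! ### The reverse Thorp shuffle -/

section Reverse

variable {k : ℕ}

/-- The cyclic rotation of the bits. -/
def rotate (k : ℕ) : Perm (Cube k) := reverseStep k fun _ => false

/-- Change the last bit according to the coin of the other bits. -/
def switchLast (k : ℕ) (Z : (Fin k → Bool) → Bool) : Perm (Cube k) :=
  (rotate k)⁻¹ * reverseStep k Z

theorem switchLast_apply (Z : (Fin k → Bool) → Bool) (x : Cube k) :
    switchLast k Z x = Fin.snoc (Fin.init x) (xor (x (Fin.last k)) (Z (Fin.init x))) := by
  change (rotate k).symm (reverseStep k Z x) = _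
  simp [rotate, reverseStep]

theorem flipBit_zero_snoc (l : Fin k → Bool) (b : Bool) :
    flipBit k 0 (Fin.snoc l b : Cube k) = (Fin.snoc l (!b) : Cube k) := by
  ext j
  rw [flipBit_apply]
  refine Fin.lastCases ?_ (fun i => ?_) j
  · simp
  · have := i.isLt
    simp [this.ne]

theorem switchLast_mem_edgeGroup (Z : (Fin k → Bool) → Bool) :
    switchLast k Z ∈ edgeGroup (flipBit k 0) Finset.univ := by
  refine ⟨fun x => ?_, fun x hx => absurd (Finset.mem_univ x) hx⟩
  rw [sameCycle_iff_of_involutive (flipBit_involutive k 0), switchLast_apply]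
  have hx := (Fin.snoc_init_self x).symm
  generalize Fin.init x = l at hx ⊢
  generalize x (Fin.last k) = b at hx ⊢
  subst hx
  rw [flipBit_zero_snoc]
  cases Z l <;> simp

theorem exists_switchLast_eq {h : Perm (Cube k)}
    (hh : h ∈ edgeGroup (flipBit k 0) Finset.univ) : ∃ Z, h = switchLast k Z := by
  refine ⟨fun l => h (Fin.snoc l false : Cube k) (Fin.last k), Equiv.ext fun x => ?_⟩
  have hcase := fun x => (sameCycle_iff_of_involutive (flipBit_involutive k 0)).1 (hh.1 x)
  rw [switchLast_apply]
  have hx := (Fin.snoc_init_self x).symm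
  generalize Fin.init x = l at hx ⊢
  generalize x (Fin.last k) = b at hx ⊢
  subst hx
  have h0 := hcase (Fin.snoc l false : Cube k)
  have h1 := hcase (Fin.snoc l true : Cube k)
  rw [flipBit_zero_snoc] at h0 h1
  have hne : h (Fin.snoc l true : Cube k) ≠ h (Fin.snoc l false : Cube k) := fun h' => by
    have := congrFun (h.injective h') (Fin.last k)
    simp at this
  rcases h0 with h0 | h0 <;> rcases h1 with h1 | h1 <;> rw [h0, h1] at hne <;>
    cases b <;> simp_all

theorem switchLast_mul (Z Z' : (Fin k → Bool) → Bool) :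
    switchLast k Z * switchLast k Z' = switchLast k fun l => xor (Z l) (Z' l) := by
  refine Equiv.ext fun x => ?_
  rw [Perm.mul_apply, switchLast_apply, switchLast_apply, switchLast_apply]
  simp only [Fin.init_snoc, Fin.snoc_last]
  congr 1
  cases Z (Fin.init x) <;> cases Z' (Fin.init x) <;> simp

/-- The permutations `switchLast k Z` run through the edge group of direction 0, so fair coins give
the average over that group. -/
theorem shuffleOp_reverseStep (k : ℕ) :
    shuffleOp (reverseStep k) =
      translate (rotate k) * edgeAvg (flipBit k 0) Finset.univ := by
  have hW : shuffleOp (reverseStep k) = translate (rotate k) * shuffleOp (switchLast k) := by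
    rw [shuffleOp, shuffleOp, mul_smul_comm, Finset.mul_sum]
    congr 1
    refine Finset.sum_congr rfl fun Z _ => ?_
    rw [← map_mul, switchLast, mul_inv_cancel_left]
  have hc : (Fintype.card ((Fin k → Bool) → Bool) : ℝ) ≠ 0 := by
    exact_mod_cast Fintype.card_ne_zero
  have h1 : shuffleOp (switchLast k) * edgeAvg (flipBit k 0) Finset.univ =
      edgeAvg (flipBit k 0) Finset.univ := by
    rw [shuffleOp, smul_mul_assoc, Finset.sum_mul, edgeAvg,
      Finset.sum_congr rfl fun Z _ => translate_mul_subgroupAvg (switchLast_mem_edgeGroup Z),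
      Finset.sum_const, Finset.card_univ, ← Nat.cast_smul_eq_nsmul ℝ, smul_smul,
      inv_mul_cancel₀ hc, one_smul]
  have h2 : shuffleOp (switchLast k) * edgeAvg (flipBit k 0) Finset.univ =
      shuffleOp (switchLast k) := by
    refine mul_subgroupAvg_of_absorb fun h hh => ?_
    obtain ⟨Z', rfl⟩ := exists_switchLast_eq hh
    rw [shuffleOp, smul_mul_assoc, Finset.sum_mul]
    congr 1
    have hinv : Function.Involutive fun (Z : (Fin k → Bool) → Bool) l => xor (Z l) (Z' l) :=
      fun Z => by simp
    refine Fintype.sum_equiv hinv.toPerm _ _ fun Z => ?_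
    rw [← map_mul, switchLast_mul]
    rfl
  rw [hW, ← h2, h1]

theorem rotate_mul_flipBit {r : ℕ} (hr : r + 1 ≤ k) :
    rotate k * flipBit k (r + 1) * (rotate k)⁻¹ = flipBit k r := by
  rw [mul_inv_eq_iff_eq_mul]
  refine Equiv.ext fun x => funext fun j => ?_
  have hrot : ∀ x : Cube k, rotate k x = Fin.cons (x (Fin.last k)) (Fin.init x) := fun x => by
    simp [rotate, reverseStep]
  rw [Perm.mul_apply, Perm.mul_apply, hrot, hrot]
  refine Fin.cases ?_ (fun i => ?_) j
  · simp only [Fin.cons_zero, flipBit_apply, Fin.val_last, Fin.val_zero]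
    rw [if_neg (by omega), if_neg (by omega)]
  · simp only [Fin.cons_succ, Fin.init, flipBit_apply, Fin.val_castSucc, Fin.val_succ]
    exact if_congr (by omega) rfl rfl

theorem edgeAvg_mul_rotate_pow {n : ℕ} (hn : n ≤ k) :
    edgeAvg (flipBit k 0) Finset.univ * translate (rotate k) ^ n =
      translate (rotate k) ^ n * edgeAvg (flipBit k n) Finset.univ := by
  induction n with
  | zero => simp
  | succ n ih =>
    have h := translate_mul_edgeAvg (rotate k) (flipBit k (n + 1)) Finset.univ
    rw [rotate_mul_flipBit hn, Finset.map_univ_equiv] at h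
    rw [pow_succ, ← mul_assoc, ih (by omega), mul_assoc, ← h, mul_assoc]

/-- Rotation conjugates direction r + 1 to direction r. Once the rotations stand on the left,
successive steps switch in directions 0, 1, 2, …. -/
theorem shuffleOp_reverseStep_pow {n : ℕ} (hn : n ≤ k + 1) :
    shuffleOp (reverseStep k) ^ n = translate (rotate k) ^ n * butterfly Finset.univ n := by
  induction n with
  | zero => simp [butterfly]
  | succ n ih =>
    rw [pow_succ', ih (by omega), shuffleOp_reverseStep, mul_assoc, ← mul_assoc (edgeAvg _ _),
      edgeAvg_mul_rotate_pow (by omega), butterfly, pow_succ']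
    simp only [mul_assoc]

theorem shuffleOp_pow_mem_convexHull (k t : ℕ) : shuffleOp (reverseStep k) ^ t ∈
    convexHull ℝ (translate '' (permsOn (Finset.univ : Finset (Cube k)) :
      Set (Perm (Cube k)))) := by
  induction t with
  | zero => exact subset_convexHull ℝ _ ⟨1, (permsOn _).one_mem, map_one _⟩
  | succ t ih =>
    rw [pow_succ]
    exact mul_mem_convexHull_translate ih (shuffleOp_mem_convexHull _)

theorem forget_univ_shuffleOp_pow (t : ℕ) (f : Perm (Cube k) → ℝ) :
    forget Finset.univ ((shuffleOp (reverseStep k) ^ t) f) = forget Finset.univ f := by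
  rw [← Module.End.mul_apply, forget, mul_eq_of_mem_convexHull_translate
    (fun h hh => subgroupAvg_mul_translate hh) (shuffleOp_pow_mem_convexHull k t)]

theorem relEntropy_round_le {f : Perm (Cube k) → ℝ} (hf : 0 ≤ f) :
    relEntropy ((shuffleOp (reverseStep k) ^ (k + 1)) f) ≤
      (1 - (64 * (4 + 3 * ((k : ℝ) + 1)))⁻¹) * relEntropy f := by
  have h2 := entropySum_butterfly_le hf
  rw [relEntropy, forget_univ_shuffleOp_pow, shuffleOp_reverseStep_pow le_rfl, ← map_pow, Module.End.mul_apply,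
    entropySum_translate, relEntropy]
  linarith

theorem relEntropy_rounds_le {f : Perm (Cube k) → ℝ} (hf : 0 ≤ f) (N : ℕ) :
    relEntropy ((shuffleOp (reverseStep k) ^ ((k + 1) * N)) f) ≤
      (1 - (64 * (4 + 3 * ((k : ℝ) + 1)))⁻¹) ^ N * relEntropy f := by
  induction N with
  | zero => simp
  | succ N ih =>
    have h0 : (64 * (4 + 3 * ((k : ℝ) + 1)))⁻¹ ≤ 1 := inv_le_one_of_one_le₀ (by
      have : (0 : ℝ) ≤ k := Nat.cast_nonneg k
      linarith)
    have h1 := relEntropy_round_le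
      (nonneg_of_mem_convexHull_translate (shuffleOp_pow_mem_convexHull k ((k + 1) * N)) hf)
    rw [← Module.End.mul_apply, ← pow_add] at h1
    rw [show (k + 1) * (N + 1) = k + 1 + (k + 1) * N by ring]
    refine h1.trans ?_
    rw [pow_succ', mul_assoc]
    exact mul_le_mul_of_nonneg_left ih (by linarith)

theorem distUniform_reverseThorp_le (k : ℕ) (π : Perm (Cube k)) :
    distUniform ((reverseThorp k ^ (3584 * (k + 1) ^ 3)) π) ≤ 1 / 4 := by
  set d : ℝ := (k : ℝ) + 1 with hd
  have hd1 : 1 ≤ d := by rw [hd]; linarith [(Nat.cast_nonneg k : (0 : ℝ) ≤ k)]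
  set f := (reverseThorp k ^ (3584 * (k + 1) ^ 3)) π with hf_def
  have hf_eq : f = (shuffleOp (reverseStep k) ^ ((k + 1) * (3584 * (k + 1) ^ 2)))
      (Pi.single π 1) := by
    rw [hf_def, reverseThorp, shuffleMatrix_pow_apply]
    congr 2
    ring
  have hδ : 0 ≤ (Pi.single π 1 : Perm (Cube k) → ℝ) := Pi.single_nonneg.2 zero_le_one
  have hmem := shuffleOp_pow_mem_convexHull k ((k + 1) * (3584 * (k + 1) ^ 2))
  have hf0 : 0 ≤ f := hf_eq ▸ nonneg_of_mem_convexHull_translate hmem hδ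
  have hforget : forget Finset.univ f = forget Finset.univ (Pi.single π 1) := by
    rw [hf_eq, forget_univ_shuffleOp_pow]
  have hsum : ∑ x, f x = 1 := by
    have h := congrFun hforget 1
    have hc : (Fintype.card (Perm (Cube k)) : ℝ) ≠ 0 := by exact_mod_cast Fintype.card_ne_zero
    rw [forget_univ_apply, forget_univ_apply, div_left_inj' hc] at h
    rw [h]
    simp
  have hent := relEntropy_rounds_le hδ (3584 * (k + 1) ^ 2)
  rw [← hf_eq, relEntropy_single, ← hd] at hent
  set n := Fintype.card (Cube k) with hn
  have hn2 : n = 2 ^ (k + 1) := by simp [hn]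
  have hfact : Real.log n.factorial ≤ Real.exp (2 * d) := by
    have hnd : (n : ℝ) ≤ Real.exp d := by
      rw [hn2, hd]
      push_cast
      calc (2 : ℝ) ^ (k + 1) ≤ Real.exp 1 ^ (k + 1) := by
            gcongr
            linarith [Real.add_one_le_exp (1 : ℝ)]
        _ = _ := by rw [← Real.exp_nat_mul]; push_cast; ring_nf
    have hn0 : (0 : ℝ) < n := by rw [hn2]; positivity
    have hlogn : Real.log n ≤ d := by
      rw [Real.log_le_iff_le_exp hn0]; exact hnd
    calc Real.log n.factorial ≤ Real.log ((n : ℝ) ^ n) := by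
          refine Real.log_le_log (by positivity) ?_
          exact_mod_cast Nat.factorial_le_pow n
      _ = n * Real.log n := Real.log_pow _ _
      _ ≤ Real.exp d * Real.exp d := by
          refine mul_le_mul hnd (hlogn.trans ?_) (Real.log_natCast_nonneg _) (Real.exp_pos _).le
          linarith [Real.add_one_le_exp d]
      _ = Real.exp (2 * d) := by rw [← Real.exp_add]; ring_nf
  -- Since 4 + 3d ≤ 7d, a round gains at least 1/(448d), and 3584 = 8 · 448. The exponent 8d beats
  -- the 2d of the initial entropy.
  have hpow : (1 - (64 * (4 + 3 * d))⁻¹) ^ (3584 * (k + 1) ^ 2) ≤ Real.exp (-(8 * d)) := by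
    set c := (64 * (4 + 3 * d))⁻¹ with hc
    have hc1 : (448 * d)⁻¹ ≤ c := by
      rw [hc]
      exact inv_anti₀ (by positivity) (by linarith)
    have hc2 : c ≤ 1 := inv_le_one_of_one_le₀ (by linarith)
    calc (1 - c) ^ (3584 * (k + 1) ^ 2) ≤ Real.exp (-c) ^ (3584 * (k + 1) ^ 2) :=
          pow_le_pow_left₀ (by linarith) (Real.one_sub_le_exp_neg c) _
      _ = Real.exp (-(c * (3584 * d ^ 2))) := by
          rw [← Real.exp_nat_mul, hd]
          push_cast
          ring_nf
      _ ≤ _ := by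
          refine Real.exp_le_exp.2 (neg_le_neg ?_)
          calc 8 * d = (448 * d)⁻¹ * (3584 * d ^ 2) := by field_simp; norm_num
            _ ≤ _ := mul_le_mul_of_nonneg_right hc1 (by positivity)
  -- The target 1/64 is (1/4)² divided by the 4 of `sq_distUniform_le`.
  have hfin : relEntropy f ≤ 1 / 64 := by
    have hlog0 : 0 ≤ Real.log n.factorial := Real.log_natCast_nonneg _
    calc relEntropy f ≤ Real.exp (-(8 * d)) * Real.exp (2 * d) :=
          hent.trans (mul_le_mul hpow hfact hlog0 (Real.exp_pos _).le)
      _ = Real.exp (-(6 * d)) := by rw [← Real.exp_add]; ring_nf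
      _ ≤ Real.exp (-6) := Real.exp_le_exp.2 (by linarith)
      _ ≤ 1 / 64 := by
          rw [Real.exp_neg, inv_eq_one_div]
          refine one_div_le_one_div_of_le (by norm_num) ?_
          calc (64 : ℝ) = 2 ^ 6 := by norm_num
            _ ≤ Real.exp 1 ^ 6 := by
                gcongr
                linarith [Real.add_one_le_exp (1 : ℝ)]
            _ = Real.exp 6 := by rw [← Real.exp_nat_mul]; norm_num
  have hsq := sq_distUniform_le hf0 hsum
  have hpos : 0 ≤ distUniform f := Finset.sum_nonneg fun _ _ => abs_nonneg _
  nlinarith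

end Reverse

/-! ### The forward shuffle as the inverse of the reverse one -/

section Forward

/-- The number with given binary digits, the leftmost digit being the most significant one. -/
def binary (k : ℕ) : (Fin k → Bool) ≃ Fin (2 ^ k) :=
  (Equiv.arrowCongr Fin.revPerm finTwoEquiv.symm).trans finFunctionFinEquiv

theorem binary_val (k : ℕ) (x : Fin k → Bool) :
    (binary k x : ℕ) = ∑ i : Fin k, (x i.rev).toNat * 2 ^ (i : ℕ) := by
  simp only [binary, Equiv.trans_apply, finFunctionFinEquiv_apply]
  refine Finset.sum_congr rfl fun i _ => ?_
  simp [Equiv.arrowCongr]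
  cases x i.rev <;> rfl

theorem binary_cons (k : ℕ) (b : Bool) (l : Fin k → Bool) :
    (binary (k + 1) (Fin.cons b l) : ℕ) = b.toNat * 2 ^ k + binary k l := by
  rw [binary_val, binary_val, Fin.sum_univ_castSucc, add_comm]
  simp [Fin.rev_castSucc]

theorem binary_snoc (k : ℕ) (l : Fin k → Bool) (b : Bool) :
    (binary (k + 1) (Fin.snoc l b) : ℕ) = 2 * binary k l + b.toNat := by
  rw [binary_val, binary_val, Fin.sum_univ_succ, add_comm, Finset.mul_sum]
  simp [Fin.rev_succ, pow_succ]
  exact Finset.sum_congr rfl fun i _ => by ring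

/-- The positions of the forward shuffle, in binary. -/
def positionEquiv (k : ℕ) : Cube k ≃ Fin (2 * 2 ^ k) :=
  (binary (k + 1)).trans (finCongr (by rw [pow_succ, mul_comm]))

theorem positionEquiv_val (k : ℕ) (x : Cube k) :
    (positionEquiv k x : ℕ) = binary (k + 1) x := rfl

/-- Undoing a reverse step takes the leading bit, the number of the pile, to the right end and adds
the coin. There it is the place within the dropped pair. -/
theorem forwardStep_eq (k : ℕ) (Z : Fin (2 ^ k) → Bool) :
    forwardStep (2 ^ k) Z =
      (positionEquiv k).permCongr (reverseStep k (fun l => Z (binary k l)))⁻¹ := by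
  refine Equiv.ext fun y => ?_
  obtain ⟨x, rfl⟩ := (positionEquiv k).surjective y
  rw [Equiv.permCongr_apply, Equiv.symm_apply_apply]
  obtain ⟨b, l, rfl⟩ : ∃ b l, x = (Fin.cons b l : Cube k) :=
    ⟨x 0, Fin.tail x, (Fin.cons_self_tail x).symm⟩
  have h1 : (reverseStep k (fun l => Z (binary k l)))⁻¹ (Fin.cons b l : Cube k) =
      (Fin.snoc l (xor b (Z (binary k l))) : Cube k) := by
    change (reverseStep k _).symm _ = _
    simp [reverseStep]
  refine Fin.ext ?_
  rw [h1, positionEquiv_val, binary_snoc,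
    forwardStep_val (2 ^ k) Z (finTwoEquiv.symm b) (binary k l)]
  · cases b <;> cases Z (binary k l) <;> rfl
  · rw [positionEquiv_val, binary_cons]
    cases b <;> rfl

theorem distUniform_forwardThorp_le (k : ℕ) (π : Perm (Fin (2 * 2 ^ k))) :
    distUniform ((forwardThorp (2 ^ k) ^ (3584 * (k + 1) ^ 3)) π) ≤ 1 / 4 := by
  have := distUniform_shuffleMatrix_inv
    (Equiv.arrowCongr (binary k).symm (Equiv.refl Bool)) (positionEquiv k)
    (ν := reverseStep k) (ν' := forwardStep (2 ^ k)) (forwardStep_eq k)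
    (3584 * (k + 1) ^ 3) π
  rw [forwardThorp, this]
  exact distUniform_reverseThorp_le k _

end Forward

theorem mixingTime_le {V : Type*} [Fintype V] [DecidableEq V] {p : Matrix V V ℝ} {t : ℕ}
    (h : ∀ x, distUniform ((p ^ t) x) ≤ 1 / 4) : mixingTime p ≤ (t : ℕ∞) :=
  iInf₂_le t h

end ThorpShuffle

/-- The shuffles with `2^(k+1)` cards, `k ≥ 0`, mix within `O((k+1)^3)` steps. -/
theorem mainTheorem1 :
    ∃ C : ℕ, ∀ k : ℕ,
      ThorpShuffle.mixingTime (ThorpShuffle.reverseThorp k) ≤ ((C * (k + 1) ^ 3 : ℕ) : ℕ∞) ∧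
      ThorpShuffle.mixingTime (ThorpShuffle.forwardThorp (2 ^ k)) ≤
        ((C * (k + 1) ^ 3 : ℕ) : ℕ∞) :=
  ⟨3584, fun k => ⟨ThorpShuffle.mixingTime_le (ThorpShuffle.distUniform_reverseThorp_le k),
    ThorpShuffle.mixingTime_le (ThorpShuffle.distUniform_forwardThorp_le k)⟩⟩
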